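/- **Setting.** Let $d\ge 1$, let $V=\{v\in\mathbb Z^d:|v|\le 1\}$ with $|\cdot|$ the Euclidean norm, let $\mathcal M$ be the space of probability measures on $V$, and $\Omega=\mathcal M^{\mathbb Z^d}$ with its Borel $\sigma$-field. For $\omega=(\omega(x,v))_{x\in\mathbb Z^d,v\in V}\in\Omega$ and $x\in\mathbb Z^d$, let $P_\omega^x$ be the law of the Markov chain $(X_n)_{n\ge0}$ on $\mathbb Z^d$ with $X_0=x$ and transition probabilities $P_\omega^x(X_{n+1}=y+v\mid X_n=y)=\omega(y,v)$. For a probability measure $P$ on $\Omega$, let $\mathbb P(F\times G)=\int_F P_\omega^{o}(G)\,P(d\omega)$ be the annealed law of the walk started at the origin $o$. Write $\omega_x=(\omega(x,v))_{v\in V}$, $\mathcal F_\Lambda=\sigma(\omega_x:x\in\Lambda)$, $d(\cdot,\cdot)$ for the $\ell^1$-distance, and $\partial_rW=\{x\notin W: d(x,W)\le r\}$. $P$ is *translation invariant* if it is preserved by all shifts $\theta^y$, $(\theta^y\omega)_x=\omega_{x+y}$. It is *uniformly elliptic* if for some $\kappa>0$, $P$-a.s., $\omega(x,e)>\kappa$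 for all $x\in\mathbb Z^d$ and all $e$ with $|e|=1$. It *satisfies (G)* if there is an integer $r\ge1$ such that 1. ($r$-Markov) for every finite $W\subset\mathbb Z^d$, $P\big((\omega_x)_{x\in W}\in\cdot\mid\mathcal F_{W^c}\big)=P\big((\omega_x)_{x\in W}\in\cdot\mid\mathcal F_{\partial_rW}\big)$, $P$-a.s.; and 2. there are constants $\gamma,C\in(0,\infty)$ such that for all finite $\Delta\subset W\subset\mathbb Z^d$ with $d(\Delta,W^c)\ge r$ and all $A\subset W^c$, $$\frac{dP\big((\omega_x)_{x\in\Delta}\in\cdot\mid\eta\big)}{dP\big((\omega_x)_{x\in\Delta}\in\cdot\mid\eta'\big)}\le\exp\Big(C\sum_{x\in A,\,y\in\Delta}e^{-\gamma d(x,y)}\Big)$$ for all $\eta,\eta'$ in some set of full $P$-measure of configurations in $\mathcal M^{W^c}$ (which may depend on $\Delta,W,A$) that agree on $W^c\setminus A$. Here $P(\cdot\mid\eta)$ is the regular conditional distribution given $(\omega_x)_{x\in W^c}=\eta$. For a path $X_\cdot$ and an integer $j\ge0$, let $\mathcal H_j=\{x: x\cdot e_1=X_0\cdot e_1+j\}$,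 let $D=\inf\{n\ge1:X_n\cdot e_1\le X_0\cdot e_1\}$, and for $c>0$ let $$R_c=\inf\Big\{n\ge0:\ \sum_{i=0}^n 1_{X_i\in\mathcal H_j}>c(j+1)^2\ \text{for some } j\ge0\Big\}\wedge D,\qquad \inf\emptyset=\infty .$$ **Theorem.** Suppose that $P$ is translation invariant, uniformly elliptic and satisfies (G). If $\mathbb P\big(\limsup_{n\to\infty}X_n\cdot e_1/n>0\big)>0$, then there is a constant $c_5>0$ such that $$\mathbb P(R_{c_5}=\infty)>0 .$$ That is, with positive annealed probability the walk never returns to or goes below its starting level after time $0$, and, on the same event, for every $j\ge0$ it visits $\mathcal H_j$ at most $c_5(j+1)^2$ times in total. -/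

import Mathlib

open MeasureTheory ProbabilityTheory Filter
open scoped ENNReal

namespace RWRE

noncomputable section

/-- The lattice `ℤ^d`, with the product measurable structure (all subsets are measurable). -/
abbrev Site (d : ℕ) : Type := Fin d → ℤ

/-- The finite set of admissible steps `{v ∈ ℤ^d : |v| ≤ 1}` for the Euclidean norm (an integer
vector of Euclidean norm at most one has its coordinates in `[-1, 1]`, see `mem_steps`). -/
def steps (d : ℕ) : Finset (Site d) :=
  (Finset.Icc (fun _ => -1) (fun _ => 1)).filter (fun v => ∑ i, v i ^ 2 ≤ 1)

theorem mem_steps {d : ℕ} (v : Site d) : v ∈ steps d ↔ ∑ i, v i ^ 2 ≤ 1 := by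
  simp only [steps, Finset.mem_filter, and_iff_right_iff_imp, Finset.mem_Icc, Pi.le_def]
  intro h
  have h1 : ∀ i, v i ^ 2 ≤ 1 := fun i =>
    (Finset.single_le_sum (f := fun i => v i ^ 2) (fun j _ => sq_nonneg _)
      (Finset.mem_univ i)).trans h
  exact ⟨fun i => (abs_le.mp (sq_le_one_iff_abs_le_one _ |>.mp (h1 i))).1,
    fun i => (abs_le.mp (sq_le_one_iff_abs_le_one _ |>.mp (h1 i))).2⟩

instance instNonemptySteps (d : ℕ) : Nonempty (steps d) :=
  ⟨⟨0, (mem_steps 0).mpr (by simp)⟩⟩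

/-- Probability measures on the finite set of steps, as probability vectors. Its Borel structure
is the one inherited from `ℝ^V`. -/
abbrev StepLaw (d : ℕ) : Type := stdSimplex ℝ (steps d)

instance instStandardBorelStepLaw (d : ℕ) : StandardBorelSpace (StepLaw d) :=
  (isClosed_stdSimplex ℝ (steps d)).measurableSet.standardBorel

/-- Environments: `ω x v` is the probability of the step `v` at the site `x`. -/
abbrev Env (d : ℕ) : Type := Site d → StepLaw d

/-! ### The walk -/

/-- One-step transition of the walk in the environment `ω`: from `y` to `y + v` with
probability `ω y v`. -/
def stepKernel {d : ℕ} (ω : Env d) : Kernel (Site d) (Site d) where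
  toFun y := ∑ v : steps d, ENNReal.ofReal (ω y v) • Measure.dirac (y + (v : Site d))
  measurable' := Measurable.of_discrete

instance instIsMarkovKernelStepKernel {d : ℕ} (ω : Env d) : IsMarkovKernel (stepKernel ω) where
  isProbabilityMeasure y := ⟨by
    change (∑ v : steps d, ENNReal.ofReal (ω y v) • Measure.dirac (y + (v : Site d))) Set.univ = 1
    simp only [Measure.coe_finsetSum, Finset.sum_apply, Measure.smul_apply, measure_univ,
      smul_eq_mul, mul_one]
    have hsum : ∑ v, ω y v = 1 := (ω y).2.2
    have hnn : ∀ v ∈ Finset.univ, 0 ≤ ω y v := fun v _ => (ω y).2.1 v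
    rw [← ENNReal.ofReal_sum_of_nonneg hnn, hsum, ENNReal.ofReal_one]⟩

/-- The transition at time `n`, as a kernel from the past up to time `n`: the Markov property. -/
def historyKernel {d : ℕ} (ω : Env d) (n : ℕ) :
    Kernel ((i : Finset.Iic n) → Site d) (Site d) :=
  (stepKernel ω).comap (fun h => h ⟨n, Finset.mem_Iic.mpr le_rfl⟩) (measurable_pi_apply _)

instance instIsMarkovKernelHistoryKernel {d : ℕ} (ω : Env d) (n : ℕ) :
    IsMarkovKernel (historyKernel ω n) := by
  unfold historyKernel; infer_instance

/-- The quenched law `P_ω^x` on paths: the law of the Markov chain with transitions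
`stepKernel ω` started at `x`, built by the Ionescu-Tulcea theorem. -/
def quenchedLaw {d : ℕ} (x : Site d) (ω : Env d) : Measure (ℕ → Site d) :=
  Kernel.traj (X := fun _ => Site d) (historyKernel ω) 0 (fun _ => x)

instance instIsProbabilityMeasureQuenchedLaw {d : ℕ} (x : Site d) (ω : Env d) :
    IsProbabilityMeasure (quenchedLaw x ω) := by
  unfold quenchedLaw; infer_instance

theorem measurable_stepKernel {d : ℕ} (y : Site d) :
    Measurable (fun ω : Env d => stepKernel ω y) := by
  refine Measure.measurable_of_measurable_coe _ fun s hs => ?_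
  change Measurable fun ω : Env d =>
    (∑ v : steps d, ENNReal.ofReal (ω y v) • Measure.dirac (y + (v : Site d))) s
  simp only [Measure.coe_finsetSum, Finset.sum_apply, Measure.smul_apply, smul_eq_mul]
  refine Finset.measurable_sum _ fun v _ => Measurable.mul_const ?_ _
  refine ENNReal.measurable_ofReal.comp ?_
  exact (measurable_pi_apply v).comp (measurable_subtype_coe.comp (measurable_pi_apply y))

theorem measurable_partialTraj {d : ℕ} (x : Site d) (n : ℕ) :
    Measurable (fun ω : Env d =>
      Kernel.partialTraj (X := fun _ => Site d) (historyKernel ω) 0 n (fun _ => x)) := by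
  induction n with
  | zero => simp only [Kernel.partialTraj_self]; exact measurable_const
  | succ n ih =>
    refine Measure.measurable_of_measurable_coe _ fun s hs => ?_
    have key : ∀ ω : Env d,
        Kernel.partialTraj (X := fun _ => Site d) (historyKernel ω) 0 (n + 1) (fun _ => x) s =
        ∑' z, Kernel.partialTraj (X := fun _ => Site d) (historyKernel ω) n (n + 1) z s *
          Kernel.partialTraj (X := fun _ => Site d) (historyKernel ω) 0 n (fun _ => x) {z} := by
      intro ω
      rw [Kernel.partialTraj_succ_eq_comp (Nat.zero_le n), Kernel.comp_apply' _ _ _ hs,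
        lintegral_countable']
    simp only [key]
    refine Measurable.tsum fun z => Measurable.mul ?_
      ((Measure.measurable_coe (MeasurableSet.singleton z)).comp ih)
    simp only [Kernel.partialTraj_succ_self]
    have key2 : ∀ ω : Env d,
        ((Kernel.id ×ₖ ((historyKernel ω n).map
            (MeasurableEquiv.piSingleton (X := fun _ => Site d) n))).map
          (IicProdIoc (X := fun _ => Site d) n (n + 1))) z s =
        stepKernel ω (z ⟨n, Finset.mem_Iic.mpr le_rfl⟩)
          {y | IicProdIoc (X := fun _ => Site d) n (n + 1)
            (z, MeasurableEquiv.piSingleton (X := fun _ => Site d) n y) ∈ s} := by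
      intro ω
      have hm : Measurable (IicProdIoc (X := fun _ => Site d) n (n + 1)) :=
        measurable_IicProdIoc
      rw [Kernel.map_apply' _ hm _ hs, Kernel.prod_apply' _ _ _ (hm hs), Kernel.id_apply,
        lintegral_dirac, Kernel.map_apply' _ (MeasurableEquiv.measurable _) _ .of_discrete]
      rfl
    simp only [key2]
    exact (Measure.measurable_coe (.of_discrete)).comp (measurable_stepKernel _)

/-- The quenched law depends measurably on the environment. -/
theorem measurable_quenchedLaw {d : ℕ} (x : Site d) :
    Measurable (fun ω : Env d => quenchedLaw x ω) := by
  refine Measurable.measure_of_isPiSystem_of_isProbabilityMeasure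
    generateFrom_measurableCylinders.symm isPiSystem_measurableCylinders fun s hs => ?_
  obtain ⟨n, S, hS, rfl⟩ : ∃ (n : ℕ) (S : Set ((i : Finset.Iic n) → Site d)),
      MeasurableSet S ∧ s = cylinder (Finset.Iic n) S := by
    obtain ⟨t, S, hS, rfl⟩ := (mem_measurableCylinders s).mp hs
    have ht : t ⊆ Finset.Iic (t.sup id) := fun i hi =>
      Finset.mem_Iic.mpr (Finset.le_sup (f := id) hi)
    exact ⟨t.sup id, Finset.restrict₂ (π := fun _ => Site d) ht ⁻¹' S,
      Finset.measurable_restrict₂ ht hS, rfl⟩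
  have key : ∀ ω : Env d, quenchedLaw x ω (cylinder (Finset.Iic n) S) =
      Kernel.partialTraj (X := fun _ => Site d) (historyKernel ω) 0 n (fun _ => x) S := by
    intro ω
    rw [← Kernel.traj_map_frestrictLe_apply, Measure.map_apply (by fun_prop) hS]
    rfl
  simp only [key]
  exact (Measure.measurable_coe hS).comp (measurable_partialTraj x n)

/-- The quenched law started at `x`, as a kernel in the environment. -/
def quenchedKernel {d : ℕ} (x : Site d) : Kernel (Env d) (ℕ → Site d) where
  toFun := quenchedLaw x
  measurable' := measurable_quenchedLaw x

instance instIsMarkovKernelQuenchedKernel {d : ℕ} (x : Site d) :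
    IsMarkovKernel (quenchedKernel x) where
  isProbabilityMeasure ω := instIsProbabilityMeasureQuenchedLaw x ω

/-- The annealed law `ℙ^x` on pairs (environment, path):
`ℙ^x (F × G) = ∫_F P_ω^x (G) P(dω)`. -/
def annealedLaw {d : ℕ} (P : Measure (Env d)) (x : Site d) : Measure (Env d × (ℕ → Site d)) :=
  P ⊗ₘ quenchedKernel x

/-! ### Hypotheses on the environment -/

/-- The `l¹`-distance on `ℤ^d`. -/
def dist1 {d : ℕ} (x y : Site d) : ℕ := ∑ i, (x i - y i).natAbs

/-- The spatial shift `(θ^y ω)_x = ω_{x + y}`. -/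
def shift {d : ℕ} (y : Site d) (ω : Env d) : Env d := fun x => ω (x + y)

/-- Invariance of the environment measure under all spatial shifts. -/
def TranslationInvariant {d : ℕ} (P : Measure (Env d)) : Prop :=
  ∀ y : Site d, MeasurePreserving (shift y) P P

/-- Uniform ellipticity: for some `κ > 0`, almost surely `ω(x, e) > κ` for all sites `x` and all
steps `e` with `|e| = 1`. -/
def UniformlyElliptic {d : ℕ} (P : Measure (Env d)) : Prop :=
  ∃ κ : ℝ, 0 < κ ∧
    ∀ᵐ ω ∂P, ∀ (x : Site d) (e : steps d), ∑ i, (e : Site d) i ^ 2 = 1 → κ < ω x e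

/-- Configurations `η ∈ M^Λ` on a set of sites `Λ`. -/
abbrev Config {d : ℕ} (Λ : Set (Site d)) : Type := Λ → StepLaw d

/-- The configuration `(ω_x)_{x ∈ Λ}`. -/
def restrictTo {d : ℕ} (Λ : Set (Site d)) (ω : Env d) : Config Λ := fun x => ω x

/-- The `σ`-field `F_Λ = σ(ω_x : x ∈ Λ)`. -/
abbrev sigmaField {d : ℕ} (Λ : Set (Site d)) : MeasurableSpace (Env d) :=
  MeasurableSpace.comap (restrictTo Λ) MeasurableSpace.pi

/-- The `r`-boundary `∂_r V` of `V`: the points outside `V` at distance at most `r` from `V`. -/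
def rBoundary {d : ℕ} (r : ℕ) (V : Set (Site d)) : Set (Site d) :=
  {x | x ∉ V ∧ ∃ y ∈ V, dist1 x y ≤ r}

/-- `r`-Markov environments: for finite `V`, the conditional law of `(ω_x)_{x ∈ V}` given
`F_{V^c}` is almost surely its conditional law given `F_{∂_r V}`. -/
def IsRMarkov {d : ℕ} (r : ℕ) (P : Measure (Env d)) : Prop :=
  ∀ (V : Finset (Site d)) (B : Set (Config (V : Set (Site d)))), MeasurableSet B →
    P⟦restrictTo (V : Set (Site d)) ⁻¹' B | sigmaField ((V : Set (Site d))ᶜ)⟧ =ᵐ[P]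
      P⟦restrictTo (V : Set (Site d)) ⁻¹' B | sigmaField (rBoundary r (V : Set (Site d)))⟧

/-- `P((ω_x)_{x ∈ Δ} ∈ · | η)` for `η ∈ M^Λ`: the regular conditional distribution of
`(ω_x)_{x ∈ Δ}` given `(ω_x)_{x ∈ Λ} = η`. -/
def condLaw {d : ℕ} (P : Measure (Env d)) [IsFiniteMeasure P] (Δ : Finset (Site d))
    (Λ : Set (Site d)) : Kernel (Config Λ) (Config (Δ : Set (Site d))) :=
  condDistrib (restrictTo (Δ : Set (Site d))) (restrictTo Λ) P

/-- The mixing condition with range `r` and constants `γ`, `C`. The set `N` is a set of full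
measure of configurations `η ∈ M^{V^c}`. A bound `dμ/dν ≤ K` on the density, with a constant
`K < ∞`, is the inequality of measures `μ ≤ K • ν`. The sum over `A` is always summable as
`γ > 0` and `Δ` is finite. -/
def MixingBound {d : ℕ} (P : Measure (Env d)) [IsFiniteMeasure P] (r : ℕ) (γ C : ℝ) : Prop :=
  ∀ Δ V : Finset (Site d), Δ ⊆ V → (∀ x ∈ Δ, ∀ y ∉ V, r ≤ dist1 x y) →
    ∀ A : Set (Site d), A ⊆ (V : Set (Site d))ᶜ →
      ∃ N : Set (Config ((V : Set (Site d))ᶜ)),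
        (∀ᵐ η ∂(P.map (restrictTo ((V : Set (Site d))ᶜ))), η ∈ N) ∧
        ∀ η ∈ N, ∀ η' ∈ N, (∀ x : ((V : Set (Site d))ᶜ : Set (Site d)), (x : Site d) ∉ A → η x = η' x) →
          condLaw P Δ ((V : Set (Site d))ᶜ) η ≤
            ENNReal.ofReal
              (Real.exp (C * ∑' x : A, ∑ y ∈ Δ, Real.exp (-γ * (dist1 (x : Site d) y : ℝ)))) •
              condLaw P Δ ((V : Set (Site d))ᶜ) η'

/-- Condition (G): the environment is `r`-Markov for some `r ≥ 1` and satisfies the mixing bound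
with this `r` and some positive finite constants `γ`, `C`. -/
def ConditionG {d : ℕ} (P : Measure (Env d)) [IsFiniteMeasure P] : Prop :=
  ∃ r : ℕ, 1 ≤ r ∧ IsRMarkov r P ∧ ∃ γ C : ℝ, 0 < γ ∧ 0 < C ∧ MixingBound P r γ C

/-! ### Path functionals in the direction `e₁` (the coordinate `0`) -/

/-- The level `H_j(x) = {y : y · e₁ = x · e₁ + j}` relative to the site `x`. -/
def level {d : ℕ} [NeZero d] (x : Site d) (j : ℕ) : Set (Site d) := {y | y 0 = x 0 + j}

open Classical in
/-- The number of visits of the path to the level `H_j(X_0)` up to time `n`. -/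
def visits {d : ℕ} [NeZero d] (X : ℕ → Site d) (j n : ℕ) : ℕ :=
  ∑ i ∈ Finset.range (n + 1), if X i ∈ level (X 0) j then 1 else 0

/-- `D = inf {n ≥ 1 : X_n · e₁ ≤ X_0 · e₁}`, with `inf ∅ = ∞`. -/
def backtrackTime {d : ℕ} [NeZero d] (X : ℕ → Site d) : ℕ∞ :=
  ⨅ n ∈ {n : ℕ | 1 ≤ n ∧ X n 0 ≤ X 0 0}, (n : ℕ∞)

/-- `R`: the first time at which some level `H_j`, `j ≥ 0`, has been visited more than
`c (j + 1)²` times, or `D`, whichever comes first (`∞` if neither happens). -/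
def timeR {d : ℕ} [NeZero d] (c : ℝ) (X : ℕ → Site d) : ℕ∞ :=
  (⨅ n ∈ {n : ℕ | ∃ j : ℕ, c * ((j : ℝ) + 1) ^ 2 < (visits X j n : ℝ)}, (n : ℕ∞)) ⊓
    backtrackTime X

/-- `limsup_n (X_n · e₁) / n`, in the extended reals. -/
def upperSpeed {d : ℕ} [NeZero d] (X : ℕ → Site d) : EReal :=
  limsup (fun n : ℕ => (((X n 0 : ℝ) / (n : ℝ) : ℝ) : EReal)) atTop

end

end RWRE

/-!
Suppose that `R_c = ∞` has annealed probability `0` for every `c`. Say that a good stretch of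
length `L` begins at a first visit to a level if from there the walk rises by `L` before it falls
by `h`, with at most `c (|j| + 1)²` visits to the relative level `j`.

A good stretch of length `L` has small conditional probability given the past before it, uniformly
in that past, when `L` is large. Indeed, few of its steps are taken less than `r` above its starting
level, so the transition probabilities there can be made uniform at the cost of a bounded factor.
The environment seen afterwards is at distance at least `r` from the past, and the mixing bound
decouples the two at the cost of another bounded factor. Without the past, good stretches of every
length would make the walk transient with quadratically many visits to the levels, and after its
last visit to its lowest levels it would realize `R_c = ∞` for some larger `c`, which is a null
event. So the probability of a good stretch tends to `0` as `L → ∞`.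

Good stretches that begin at levels separated by `L` are therefore jointly exponentially rare, and
almost surely at most a quarter of the first `n` levels begin a good stretch of length `L` once
`n` is large. A positive speed contradicts this. If the level `n` is reached by the time `A n`, then
few levels see too many visits to the levels around them. And over `8 A` scales `(h, L)`, each
beyond the previous one, every level from which the walk falls by `h` before it rises by `L` is paid
for by a level nearby that takes a time of order `h` to cross. So at some scale more than a quarter
of the levels begin a good stretch.
-/

namespace RWRE

section Paths

variable {S : Type*}

/-- The path after time `n`. -/
def after (n : ℕ) (X : ℕ → S) : ℕ → S := fun i => X (n + i)

theorem dependsOn_mem_cylinder (γ : ℕ → S) (n : ℕ) :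
    DependsOn (· ∈ PiNat.cylinder γ n) (Set.Iio n) := fun X Y h =>
  propext <| forall₂_congr fun i hi => by rw [h i hi]

theorem dependsOn_mem_inter {A B : Set (ℕ → S)} {s : Set ℕ} (hA : DependsOn (· ∈ A) s)
    (hB : DependsOn (· ∈ B) s) : DependsOn (· ∈ A ∩ B) s := fun _ _ h =>
  congrArg₂ And (hA h) (hB h)

theorem preimage_domRestrict_singleton (γ : ℕ → S) (n : ℕ) :
    (Set.Iio n).domRestrict (π := fun _ => S) ⁻¹' {(Set.Iio n).domRestrict γ} =
      PiNat.cylinder γ n := by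
  ext X
  simp only [Set.mem_preimage, Set.mem_singleton_iff, funext_iff, Subtype.forall,
    PiNat.mem_cylinder_iff, Set.mem_Iio, Set.domRestrict_apply]

theorem cylinder_inter_preimage_after (X : ℕ → S) (n k : ℕ) :
    PiNat.cylinder X (n + 1) ∩ after n ⁻¹' PiNat.cylinder (after n X) (k + 1) =
      PiNat.cylinder X (n + k + 1) := by
  ext Y
  simp only [Set.mem_inter_iff, Set.mem_preimage, PiNat.mem_cylinder_iff, after]
  refine ⟨fun h i hi => ?_, fun h => ⟨fun i hi => h i (by omega), fun i hi => h _ (by omega)⟩⟩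
  obtain hin | ⟨j, rfl⟩ := (le_total i n).imp_right Nat.exists_eq_add_of_le
  · exact h.1 i (by omega)
  · exact h.2 j (by omega)

theorem cylinder_inter_preimage_after_nonempty {γ γ' : ℕ → S} {n : ℕ} (h : γ' 0 = γ n) (k : ℕ) :
    (PiNat.cylinder γ (n + 1) ∩ after n ⁻¹' PiNat.cylinder γ' (k + 1)).Nonempty := by
  refine ⟨fun i => if i < n then γ i else γ' (i - n), fun i hi => ?_, fun i _ => ?_⟩
  · rcases (Nat.lt_succ_iff.mp hi).lt_or_eq with hin | rfl
    · exact if_pos hin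
    · simp only [lt_irrefl, if_false, Nat.sub_self, h]
  · simp only [after, Nat.not_lt.mpr (Nat.le_add_right n i), if_false, Nat.add_sub_cancel_left]

theorem preimage_image_domRestrict {A : Set (ℕ → S)} {s : Set ℕ} (hA : DependsOn (· ∈ A) s) :
    s.domRestrict (π := fun _ => S) ⁻¹' (s.domRestrict '' A) = A := by
  refine (Set.subset_preimage_image _ _).antisymm' ?_
  rintro X ⟨Y, hY, hYX⟩
  exact (hA fun i hi => congrFun hYX ⟨i, hi⟩).mp hY

variable [MeasurableSpace S]

theorem measurable_after (n : ℕ) : Measurable (after (S := S) n) :=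
  measurable_pi_lambda _ fun i => measurable_pi_apply (n + i)

variable [Countable S] [MeasurableSingletonClass S]

theorem measurableSet_of_dependsOn {A : Set (ℕ → S)} {n : ℕ}
    (hA : DependsOn (· ∈ A) (Set.Iio n)) : MeasurableSet A := by
  rw [← preimage_image_domRestrict hA]
  exact measurableSet_preimage (by fun_prop) .of_discrete

theorem measurableSet_cylinder (γ : ℕ → S) (n : ℕ) : MeasurableSet (PiNat.cylinder γ n) :=
  measurableSet_of_dependsOn (dependsOn_mem_cylinder γ n)

theorem measure_le_of_cylinder {μ ν : Measure (ℕ → S)} {A : Set (ℕ → S)} {n : ℕ}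
    (hA : DependsOn (· ∈ A) (Set.Iio n))
    (h : ∀ γ ∈ A, μ (PiNat.cylinder γ n) ≤ ν (PiNat.cylinder γ n)) : μ A ≤ ν A := by
  have hmeas : ∀ g ∈ (Set.Iio n).domRestrict '' A,
      MeasurableSet ((Set.Iio n).domRestrict (π := fun _ => S) ⁻¹' {g}) :=
    fun g _ => measurableSet_preimage (by fun_prop) .of_discrete
  rw [← preimage_image_domRestrict hA, ← tsum_measure_preimage_singleton (Set.to_countable _) hmeas,
    ← tsum_measure_preimage_singleton (Set.to_countable _) hmeas]
  refine ENNReal.tsum_le_tsum ?_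
  rintro ⟨_, γ, hγ, rfl⟩
  rw [preimage_domRestrict_singleton]
  exact h γ hγ

theorem measure_eq_of_cylinder {μ ν : Measure (ℕ → S)} {A : Set (ℕ → S)} {n : ℕ}
    (hA : DependsOn (· ∈ A) (Set.Iio n))
    (h : ∀ γ ∈ A, μ (PiNat.cylinder γ n) = ν (PiNat.cylinder γ n)) : μ A = ν A :=
  (measure_le_of_cylinder hA fun γ hγ => (h γ hγ).le).antisymm
    (measure_le_of_cylinder hA fun γ hγ => (h γ hγ).ge)

theorem measure_eq_zero_of_cylinder {μ : Measure (ℕ → S)} {A : Set (ℕ → S)} {n : ℕ}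
    (hA : DependsOn (· ∈ A) (Set.Iio n)) (h : ∀ γ ∈ A, μ (PiNat.cylinder γ n) = 0) : μ A = 0 :=
  measure_eq_of_cylinder (ν := 0) hA h

theorem ext_of_cylinder {μ ν : Measure (ℕ → S)} [IsFiniteMeasure μ]
    (h : ∀ (γ : ℕ → S) n, μ (PiNat.cylinder γ (n + 1)) = ν (PiNat.cylinder γ (n + 1))) : μ = ν := by
  refine ext_of_generate_finite (measurableCylinders fun _ : ℕ => S)
    generateFrom_measurableCylinders.symm isPiSystem_measurableCylinders ?_
    (measure_eq_of_cylinder (n := 1) (fun _ _ _ => rfl) fun γ _ => h γ 0)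
  intro A hA
  obtain ⟨t, T, -, rfl⟩ := (mem_measurableCylinders A).mp hA
  refine measure_eq_of_cylinder (n := t.sup id + 1) (fun X Y hXY => ?_) fun γ _ => h γ _
  have : t.restrict X = t.restrict Y := funext fun i =>
    hXY i (Nat.lt_succ_of_le (Finset.le_sup (f := id) i.2))
  simp only [mem_cylinder, this]

end Paths

section Chains

variable {S : Type*} [MeasurableSpace S]

/-- The law of the Markov chain with transition kernel `κ` started at `x`. The walk in a fixed
environment `ω` is the case `κ = stepKernel ω`, definitionally. -/
noncomputable def chainLaw (κ : Kernel S S) [IsMarkovKernel κ] (x : S) : Measure (ℕ → S) :=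
  Kernel.traj (X := fun _ => S)
    (fun n => κ.comap (fun h : Finset.Iic n → S => h ⟨n, Finset.mem_Iic.mpr le_rfl⟩)
      (measurable_pi_apply _)) 0 (fun _ => x)

instance (κ : Kernel S S) [IsMarkovKernel κ] (x : S) : IsProbabilityMeasure (chainLaw κ x) := by
  unfold chainLaw; infer_instance

/-- The product of the transition probabilities of `κ` along the first `n` steps of `γ`. -/
noncomputable def pathWeight (κ : Kernel S S) (n : ℕ) (γ : ℕ → S) : ℝ≥0∞ :=
  ∏ i ∈ Finset.range n, κ (γ i) {γ (i + 1)}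

theorem pathWeight_congr {κ κ' : Kernel S S} {n : ℕ} {γ γ' : ℕ → S} (hγ : ∀ i ≤ n, γ i = γ' i)
    (hκ : ∀ i < n, κ (γ i) = κ' (γ i)) : pathWeight κ n γ = pathWeight κ' n γ' := by
  refine Finset.prod_congr rfl fun i hi => ?_
  have hi := Finset.mem_range.mp hi
  rw [← hγ i hi.le, ← hγ (i + 1) hi, hκ i hi]

theorem pathWeight_add (κ : Kernel S S) (n k : ℕ) (γ : ℕ → S) :
    pathWeight κ (n + k) γ = pathWeight κ n γ * pathWeight κ k (after n γ) :=
  Finset.prod_range_add _ n k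

variable [Countable S] [MeasurableSingletonClass S] (κ : Kernel S S) [IsMarkovKernel κ]

theorem chainLaw_cylinder_succ (x : S) (n : ℕ) (γ : ℕ → S) :
    chainLaw κ x (PiNat.cylinder γ (n + 2)) =
      chainLaw κ x (PiNat.cylinder γ (n + 1)) * κ (γ n) {γ (n + 1)} := by
  have hcyl : PiNat.cylinder γ (n + 1) =
      Preorder.frestrictLe (π := fun _ => S) n ⁻¹' {Preorder.frestrictLe n γ} := by
    ext X
    simp only [PiNat.mem_cylinder_iff, Nat.lt_succ_iff, Set.mem_preimage, Set.mem_singleton_iff,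
      funext_iff, Subtype.forall, Finset.mem_Iic, Preorder.frestrictLe_apply]
  have hcyl_succ : PiNat.cylinder γ (n + 2) =
      (fun X => (Preorder.frestrictLe (π := fun _ => S) n X, X (n + 1))) ⁻¹'
        ({Preorder.frestrictLe n γ} ×ˢ {γ (n + 1)}) := by
    rw [Set.mk_preimage_prod, ← hcyl]
    ext X
    simp only [PiNat.mem_cylinder_iff, Nat.lt_succ_iff (n := n + 1), Nat.le_succ_iff,
      Nat.lt_succ_iff (n := n), or_imp, forall_and, forall_eq, Set.mem_inter_iff,
      Set.mem_preimage, Set.mem_singleton_iff]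
  rw [hcyl, hcyl_succ, ← Measure.map_apply (by fun_prop) .of_discrete,
    ← Measure.map_apply (by fun_prop) .of_discrete, chainLaw,
    ← Kernel.partialTraj_compProd_eq_map_traj (Nat.zero_le n),
    Kernel.traj_map_frestrictLe_apply,
    Measure.compProd_apply_prod .of_discrete .of_discrete, lintegral_singleton, mul_comm]
  rfl

theorem chainLaw_cylinder (x : S) (n : ℕ) (γ : ℕ → S) :
    chainLaw κ x (PiNat.cylinder γ (n + 1)) = Measure.dirac x {γ 0} * pathWeight κ n γ := by
  induction n with
  | zero =>
    have hcyl : PiNat.cylinder γ 1 = Preorder.frestrictLe (π := fun _ => S) 0 ⁻¹'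
        ((fun g => g ⟨0, Finset.mem_Iic.mpr le_rfl⟩) ⁻¹' {γ 0}) := by
      ext X
      simp only [PiNat.mem_cylinder_iff, Nat.lt_one_iff, forall_eq, Set.mem_preimage,
        Set.mem_singleton_iff, Preorder.frestrictLe_apply]
    rw [hcyl, ← Measure.map_apply (by fun_prop) .of_discrete, chainLaw,
      Kernel.traj_map_frestrictLe_apply, Kernel.partialTraj_self, Kernel.id_apply,
      ← Measure.map_apply (by fun_prop) .of_discrete, Measure.map_dirac' (by fun_prop), pathWeight,
      Finset.prod_range_zero, mul_one]
  | succ n ih =>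
    rw [chainLaw_cylinder_succ, ih, pathWeight, pathWeight, Finset.prod_range_succ, mul_assoc]

theorem ae_chainLaw_zero (x : S) : ∀ᵐ X ∂chainLaw κ x, X 0 = x := by
  refine measure_eq_zero_of_cylinder (n := 1)
    (fun X Y h => by simp only [Set.mem_compl_iff, Set.mem_ofPred_eq, h 0 Nat.one_pos])
    fun γ hγ => ?_
  rw [chainLaw_cylinder, Measure.dirac_apply' _ (.singleton _),
    Set.indicator_of_notMem (fun h => hγ (Set.mem_singleton_iff.mp h).symm), zero_mul]

theorem chainLaw_cylinder_add (x : S) (X : ℕ → S) (n k : ℕ) :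
    chainLaw κ x (PiNat.cylinder X (n + k + 1)) =
      chainLaw κ x (PiNat.cylinder X (n + 1)) *
        chainLaw κ (X n) (PiNat.cylinder (after n X) (k + 1)) := by
  have hself : Measure.dirac (X n) {after n X 0} = 1 :=
    Measure.dirac_apply_of_mem (Set.mem_singleton _)
  rw [chainLaw_cylinder, chainLaw_cylinder, chainLaw_cylinder, pathWeight_add, hself, one_mul,
    mul_assoc]

theorem chainLaw_cylinder_inter_after (x : S) (n : ℕ) (γ : ℕ → S) {B : Set (ℕ → S)}
    (hB : MeasurableSet B) :
    chainLaw κ x (PiNat.cylinder γ (n + 1) ∩ after n ⁻¹' B) =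
      chainLaw κ x (PiNat.cylinder γ (n + 1)) * chainLaw κ (γ n) B := by
  have key : ((chainLaw κ x).restrict (PiNat.cylinder γ (n + 1))).map (after n) =
      chainLaw κ x (PiNat.cylinder γ (n + 1)) • chainLaw κ (γ n) := by
    refine ext_of_cylinder fun γ' k => ?_
    rw [Measure.map_apply (measurable_after n) (measurableSet_cylinder _ _),
      Measure.restrict_apply (measurable_after n (measurableSet_cylinder _ _)),
      Measure.smul_apply, smul_eq_mul, Set.inter_comm]
    rcases (PiNat.cylinder γ (n + 1) ∩
      after n ⁻¹' PiNat.cylinder γ' (k + 1)).eq_empty_or_nonempty with hempty | ⟨X, hX, hX'⟩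
    · have hne : γ' 0 ≠ γ n := fun h =>
        (cylinder_inter_preimage_after_nonempty h k).ne_empty hempty
      rw [hempty, measure_empty, chainLaw_cylinder κ (γ n), Measure.dirac_apply' _ (.singleton _),
        Set.indicator_of_notMem (by simpa only [Set.mem_singleton_iff] using hne.symm), zero_mul,
        mul_zero]
    · rw [← hX n n.lt_succ_self, ← PiNat.mem_cylinder_iff_eq.mp hX,
        ← PiNat.mem_cylinder_iff_eq.mp hX', cylinder_inter_preimage_after, chainLaw_cylinder_add]
  have := congrArg (· B) key
  simpa only [Measure.map_apply (measurable_after n) hB, Measure.smul_apply, smul_eq_mul,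
    Measure.restrict_apply (measurable_after n hB), Set.inter_comm] using this

theorem chainLaw_preimage_after_null {B : Set (ℕ → S)} (hB : MeasurableSet B)
    (hnull : ∀ z, chainLaw κ z B = 0) (x : S) (n : ℕ) : chainLaw κ x (after n ⁻¹' B) = 0 := by
  rw [← Measure.restrict_apply_univ]
  refine measure_eq_zero_of_cylinder (n := n + 1) (fun _ _ _ => rfl) fun γ _ => ?_
  rw [Measure.restrict_apply (measurableSet_cylinder _ _),
    chainLaw_cylinder_inter_after κ x n γ hB, hnull, mul_zero]

theorem ae_chainLaw_transition_ne_zero (x : S) :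
    ∀ᵐ X ∂chainLaw κ x, ∀ n, κ (X n) {X (n + 1)} ≠ 0 := by
  refine ae_all_iff.mpr fun n => measure_eq_zero_of_cylinder (n := n + 2) (fun X Y h => ?_)
    fun γ hγ => ?_
  · simp only [Set.mem_compl_iff, Set.mem_ofPred_eq, h n (Set.mem_Iio.mpr (by omega)),
      h (n + 1) (Set.mem_Iio.mpr (by omega))]
  · rw [chainLaw_cylinder_succ, not_not.mp hγ, mul_zero]

variable {κ}

theorem chainLaw_inter_forall_mem {κ' : Kernel S S} [IsMarkovKernel κ'] {U : Set S}
    (hU : ∀ y ∈ U, κ y = κ' y) (x : S) {B : Set (ℕ → S)} (hB : MeasurableSet B) :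
    chainLaw κ x (B ∩ {X | ∀ i, X i ∈ U}) = chainLaw κ' x (B ∩ {X | ∀ i, X i ∈ U}) := by
  suffices (chainLaw κ x).restrict {X | ∀ i, X i ∈ U} =
      (chainLaw κ' x).restrict {X | ∀ i, X i ∈ U} by
    simpa only [Measure.restrict_apply hB] using congrArg (· B) this
  refine ext_of_cylinder fun γ n => ?_
  let A : ℕ → Set (ℕ → S) := fun N => PiNat.cylinder γ (n + 1) ∩ {X | ∀ i ≤ n + N, X i ∈ U}
  have hA : ∀ N, DependsOn (· ∈ A N) (Set.Iio (n + N + 1)) := fun N =>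
    dependsOn_mem_inter ((dependsOn_mem_cylinder γ _).mono (Set.Iio_subset_Iio (by omega)))
      fun X Y h => propext <| forall₂_congr fun i hi => by rw [h i (Nat.lt_succ_of_le hi)]
  have hA_anti : Antitone A := fun _ _ hNM _ hX => ⟨hX.1, fun i hi => hX.2 i (by omega)⟩
  have hA_iInter : PiNat.cylinder γ (n + 1) ∩ {X | ∀ i, X i ∈ U} = ⋂ N, A N := by
    ext X
    simp only [A, Set.mem_inter_iff, Set.mem_ofPred_eq, Set.mem_iInter]
    exact ⟨fun h N => ⟨h.1, fun i _ => h.2 i⟩, fun h => ⟨(h 0).1, fun i => (h i).2 i (by omega)⟩⟩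
  have hA_eq : ∀ N, chainLaw κ x (A N) = chainLaw κ' x (A N) := fun N =>
    measure_eq_of_cylinder (hA N) fun γ' hγ' => by
      rw [chainLaw_cylinder, chainLaw_cylinder,
        pathWeight_congr (fun _ _ => rfl) fun i hi => hU _ (hγ'.2 i hi.le)]
  have hA_meas : ∀ N, MeasurableSet (A N) := fun N => measurableSet_of_dependsOn (hA N)
  rw [Measure.restrict_apply (measurableSet_cylinder _ _),
    Measure.restrict_apply (measurableSet_cylinder _ _), hA_iInter,
    hA_anti.measure_iInter (fun N => (hA_meas N).nullMeasurableSet) ⟨0, measure_ne_top _ _⟩,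
    hA_anti.measure_iInter (fun N => (hA_meas N).nullMeasurableSet) ⟨0, measure_ne_top _ _⟩]
  simp only [hA_eq]

theorem chainLaw_map_equiv {S' : Type*} [MeasurableSpace S'] [Countable S']
    [MeasurableSingletonClass S'] {κ' : Kernel S' S'} [IsMarkovKernel κ'] (e : S ≃ S')
    (he : ∀ y z, κ' (e y) {e z} = κ y {z}) (x : S) :
    (chainLaw κ x).map (fun X n => e (X n)) = chainLaw κ' (e x) := by
  have hmeas : Measurable fun (X : ℕ → S) n => e (X n) :=
    measurable_pi_lambda _ fun n => (Measurable.of_discrete (f := e)).comp (measurable_pi_apply n)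
  refine ext_of_cylinder fun γ n => ?_
  obtain ⟨γ, rfl⟩ : ∃ γ₀ : ℕ → S, γ = fun i => e (γ₀ i) :=
    ⟨fun i => e.symm (γ i), by simp only [Equiv.apply_symm_apply]⟩
  have hpre : (fun (X : ℕ → S) n => e (X n)) ⁻¹' PiNat.cylinder (fun i => e (γ i)) (n + 1) =
      PiNat.cylinder γ (n + 1) := by
    ext X; simp only [Set.mem_preimage, PiNat.mem_cylinder_iff, e.apply_eq_iff_eq]
  have hstart : Measure.dirac (e x) {e (γ 0)} = Measure.dirac x {γ 0} := by
    rw [← Measure.map_dirac' Measurable.of_discrete, Measure.map_apply .of_discrete .of_discrete,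
      ← Set.image_singleton, Set.preimage_image_eq _ e.injective]
  rw [Measure.map_apply hmeas (measurableSet_cylinder _ _), hpre, chainLaw_cylinder,
    chainLaw_cylinder, hstart, pathWeight, pathWeight]
  simp only [he]

end Chains

section ExponentialSums

variable {d : ℕ}

theorem dist1_comm (x y : Site d) : dist1 x y = dist1 y x :=
  Finset.sum_congr rfl fun i _ => by omega

theorem natAbs_sub_le_dist1 (x y : Site d) (i : Fin d) : (x i - y i).natAbs ≤ dist1 x y :=
  Finset.single_le_sum (f := fun i => (x i - y i).natAbs) (fun _ _ => Nat.zero_le _)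
    (Finset.mem_univ i)

theorem finite_setOf_dist1_le (y : Site d) (n : ℕ) : {x : Site d | dist1 x y ≤ n}.Finite := by
  refine (Set.finite_Icc (fun i => y i - n) (fun i => y i + n)).subset fun x hx => ?_
  have hcoord : ∀ i, (x i - y i).natAbs ≤ n := fun i => (natAbs_sub_le_dist1 x y i).trans hx
  exact ⟨fun i => by grind, fun i => by grind⟩

theorem summable_exp_natAbs {a : ℝ} (ha : 0 < a) :
    Summable fun k : ℤ => Real.exp (-a * k.natAbs) := by
  have hnat : Summable fun n : ℕ => Real.exp (-a * n) := by
    simpa only [mul_comm] using Real.summable_exp_nat_mul_iff.mpr (neg_lt_zero.mpr ha)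
  refine Summable.of_nat_of_neg ?_ ?_ <;> simpa only [Int.natAbs_neg, Int.natAbs_natCast]

theorem summable_exp_dist1 {a : ℝ} (ha : 0 < a) (y : Site d) :
    Summable fun x : Site d => Real.exp (-a * dist1 x y) := by
  have hprod : ∀ x : Site d,
      Real.exp (-a * dist1 x y) = ∏ i, Real.exp (-a * (x i - y i).natAbs) := fun x => by
    rw [← Real.exp_sum, ← Finset.mul_sum, dist1, Nat.cast_sum]
  have hcoord : ∀ i, Summable fun k : ℤ => Real.exp (-a * (k - y i).natAbs) := fun i =>
    (Equiv.subRight (y i)).summable_iff.mpr (summable_exp_natAbs ha)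
  refine summable_of_sum_le (c := ∏ i : Fin d, ∑' k : ℤ, Real.exp (-a * (k - y i).natAbs))
    (fun _ => (Real.exp_pos _).le) fun s => ?_
  calc ∑ x ∈ s, Real.exp (-a * dist1 x y)
      ≤ ∑ x ∈ Fintype.piFinset fun i => s.image fun x : Site d => x i,
          ∏ i, Real.exp (-a * (x i - y i).natAbs) := by
        simp only [hprod]
        refine Finset.sum_le_sum_of_subset_of_nonneg (fun x hx => ?_) fun _ _ _ => by positivity
        exact Fintype.mem_piFinset.mpr fun i => Finset.mem_image_of_mem (fun x : Site d => x i) hx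
    _ = ∏ i, ∑ k ∈ s.image fun x => x i, Real.exp (-a * (k - y i).natAbs) :=
        (Finset.prod_univ_sum (fun i : Fin d => s.image fun x : Site d => x i)
          fun i k => Real.exp (-a * (k - y i).natAbs)).symm
    _ ≤ _ := Finset.prod_le_prod (fun _ _ => Finset.sum_nonneg fun _ _ => (Real.exp_pos _).le)
        fun i _ => (hcoord i).sum_le_tsum _ fun _ _ => (Real.exp_pos _).le

theorem tsum_exp_dist1_eq (a : ℝ) (y : Site d) :
    ∑' x : Site d, Real.exp (-a * dist1 x y) = ∑' x : Site d, Real.exp (-a * dist1 x 0) := by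
  rw [← (Equiv.subRight y).tsum_eq fun x => Real.exp (-a * dist1 x 0)]
  simp only [dist1, Equiv.subRight_apply, Pi.sub_apply, Pi.zero_apply, sub_zero]

theorem tsum_exp_dist1_le {a : ℝ} (ha : 0 < a) {y : Site d} {A : Set (Site d)} {ρ : ℝ}
    (hA : ∀ x ∈ A, ρ ≤ dist1 x y) :
    ∑' x : A, Real.exp (-a * dist1 (x : Site d) y) ≤
      (∑' x : Site d, Real.exp (-(a / 2) * dist1 x 0)) * Real.exp (-(a / 2) * ρ) := by
  have hsum := summable_exp_dist1 (half_pos ha) y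
  calc ∑' x : A, Real.exp (-a * dist1 (x : Site d) y)
      ≤ ∑' x : A, Real.exp (-(a / 2) * dist1 (x : Site d) y) * Real.exp (-(a / 2) * ρ) := by
        refine Summable.tsum_le_tsum (fun x => ?_) ((summable_exp_dist1 ha y).subtype A)
          ((hsum.subtype A).mul_right _)
        rw [← Real.exp_add, Real.exp_le_exp]
        nlinarith [hA x x.2]
    _ = (∑' x : A, Real.exp (-(a / 2) * dist1 (x : Site d) y)) * Real.exp (-(a / 2) * ρ) :=
        tsum_mul_right
    _ ≤ _ := by
        rw [← tsum_exp_dist1_eq _ y]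
        gcongr
        exact hsum.tsum_subtype_le (fun x => Real.exp (-(a / 2) * dist1 x y)) A
          fun _ => (Real.exp_pos _).le

end ExponentialSums

section Decoupling

theorem map_prodMk_le_of_condDistrib_le {α β γ : Type*} [MeasurableSpace α] [MeasurableSpace β]
    [MeasurableSpace γ] [StandardBorelSpace γ] [Nonempty γ] {μ : Measure α}
    [IsProbabilityMeasure μ] {X : α → β} {Y : α → γ} (hX : Measurable X) (hY : Measurable Y)
    {K : ℝ≥0∞} (hK : ∀ᵐ b ∂μ.map X, ∀ᵐ b' ∂μ.map X,
      condDistrib Y X μ b ≤ K • condDistrib Y X μ b') :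
    μ.map (fun a => (X a, Y a)) ≤ K • (μ.map X).prod (μ.map Y) := by
  have : IsProbabilityMeasure (μ.map X) := Measure.isProbabilityMeasure_map hX.aemeasurable
  have hcond : ∀ᵐ b ∂μ.map X, condDistrib Y X μ b ≤ K • μ.map Y := by
    filter_upwards [hK] with b hb
    refine Measure.le_iff.mpr fun s hs => ?_
    calc condDistrib Y X μ b s = ∫⁻ _, condDistrib Y X μ b s ∂μ.map X := by
          rw [lintegral_const, measure_univ, mul_one]
      _ ≤ ∫⁻ b', K * condDistrib Y X μ b' s ∂μ.map X :=
          lintegral_mono_ae (hb.mono fun b' hb' => hb' s)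
      _ = (K • μ.map Y) s := by
          rw [lintegral_const_mul _ (Kernel.measurable_coe _ hs), Measure.smul_apply, smul_eq_mul,
            ← condDistrib_comp_map hX.aemeasurable hY.aemeasurable,
            Measure.bind_apply hs (Kernel.aemeasurable _)]
  rw [← compProd_map_condDistrib hY.aemeasurable]
  refine Measure.le_iff.mpr fun s hs => ?_
  rw [Measure.compProd_apply hs, Measure.smul_apply, smul_eq_mul, Measure.prod_apply hs,
    ← lintegral_const_mul _ (measurable_measure_prodMk_left hs)]
  exact lintegral_mono_ae (hcond.mono fun b hb => hb _)

theorem exists_measurable_comp_domRestrict {ι β : Type*} {X : ι → Type*}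
    [∀ i, MeasurableSpace (X i)] [∀ i, Nonempty (X i)] [MeasurableSpace β] {f : (∀ i, X i) → β}
    (hf : Measurable f) {s : Set ι} (hfs : DependsOn f s) :
    ∃ g : (∀ i : s, X i) → β, Measurable g ∧ f = g ∘ s.domRestrict := by
  classical
  let extend : (∀ i : s, X i) → ∀ i, X i := fun x i =>
    if h : i ∈ s then x ⟨i, h⟩ else Classical.arbitrary _
  have hextend : Measurable extend := measurable_pi_lambda _ fun i => by
    by_cases h : i ∈ s
    · simpa only [extend, dif_pos h] using measurable_pi_apply (⟨i, h⟩ : s)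
    · simpa only [extend, dif_neg h] using measurable_const
  refine ⟨f ∘ extend, hf.comp hextend, funext fun x => hfs fun i hi => ?_⟩
  simp only [extend, dif_pos hi, Set.domRestrict_apply]

variable {d : ℕ} {P : Measure (Env d)} [IsProbabilityMeasure P] {r : ℕ} {γ C : ℝ}

theorem measurable_restrictTo (Λ : Set (Site d)) : Measurable (restrictTo Λ) :=
  measurable_pi_lambda _ fun _ => measurable_pi_apply _

theorem lintegral_mul_le_of_mixingBound (hmix : MixingBound P r γ C) {Δ V : Finset (Site d)}
    (hΔV : Δ ⊆ V) (hdist : ∀ y ∈ Δ, ∀ x ∉ V, r ≤ dist1 y x) {f g : Env d → ℝ≥0∞}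
    (hf : Measurable f) (hg : Measurable g) (hfV : DependsOn f (V : Set (Site d))ᶜ)
    (hgΔ : DependsOn g (Δ : Set (Site d))) :
    ∫⁻ ω, f ω * g ω ∂P ≤ ENNReal.ofReal (Real.exp (C *
        ∑' x : ((V : Set (Site d))ᶜ : Set (Site d)), ∑ y ∈ Δ,
          Real.exp (-γ * dist1 (x : Site d) y))) *
      ((∫⁻ ω, f ω ∂P) * ∫⁻ ω, g ω ∂P) := by
  obtain ⟨N, hN, hK⟩ := hmix Δ V hΔV hdist _ subset_rfl
  obtain ⟨f, hf', rfl⟩ := exists_measurable_comp_domRestrict hf hfV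
  obtain ⟨g, hg', rfl⟩ := exists_measurable_comp_domRestrict hg hgΔ
  have hle := map_prodMk_le_of_condDistrib_le (measurable_restrictTo (V : Set (Site d))ᶜ)
    (measurable_restrictTo (Δ : Set (Site d))) <| hN.mono fun η hη => hN.mono fun η' hη' =>
      hK η hη η' hη' fun x hx => absurd x.2 hx
  have hprod : Measurable fun p : Config (V : Set (Site d))ᶜ × Config (Δ : Set (Site d)) =>
      f p.1 * g p.2 := by fun_prop
  have := lintegral_mono' hle (le_refl fun p => f p.1 * g p.2)
  rwa [lintegral_map hprod ((measurable_restrictTo _).prodMk (measurable_restrictTo _)),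
    lintegral_smul_measure, lintegral_prod_mul hf'.aemeasurable hg'.aemeasurable,
    lintegral_map hf' (measurable_restrictTo _),
    lintegral_map hg' (measurable_restrictTo _)] at this

variable [NeZero d]

theorem exists_finset_dist1_ge (m : ℤ) {Δ : Finset (Site d)} (hΔ : ∀ y ∈ Δ, m ≤ y 0) :
    ∃ V : Finset (Site d), Δ ⊆ V ∧ (∀ x ∈ V, m ≤ x 0) ∧
      ∀ y ∈ Δ, ∀ x ∉ V, y 0 - m ≤ dist1 x y := by
  have hfin : {x : Site d | m ≤ x 0 ∧ ∃ y ∈ Δ, dist1 x y ≤ (y 0 - m).toNat}.Finite :=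
    (Δ.finite_toSet.biUnion fun y _ => finite_setOf_dist1_le y (y 0 - m).toNat).subset
      fun x ⟨_, y, hy, hxy⟩ => Set.mem_iUnion₂.mpr ⟨y, hy, hxy⟩
  refine ⟨hfin.toFinset, fun y hy => ?_, fun x hx => ((hfin.mem_toFinset).mp hx).1,
    fun y hy x hx => ?_⟩
  · exact hfin.mem_toFinset.mpr ⟨hΔ y hy, y, hy, by simp [dist1]⟩
  · by_contra! hlt
    have := natAbs_sub_le_dist1 x y 0
    exact hx (hfin.mem_toFinset.mpr ⟨by omega, y, hy, by omega⟩)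

theorem exists_lintegral_mul_le_of_mixingBound (hγ : 0 < γ) (hmix : MixingBound P r γ C) :
    ∃ T : ℝ, 0 ≤ T ∧ ∀ (m : ℤ) (Δ : Finset (Site d)), (∀ y ∈ Δ, m + r ≤ y 0) →
      ∀ f g : Env d → ℝ≥0∞, Measurable f → Measurable g →
      DependsOn f {x : Site d | x 0 < m} → DependsOn g (Δ : Set (Site d)) →
      ∫⁻ ω, f ω * g ω ∂P ≤
        ENNReal.ofReal (Real.exp (T * ∑ y ∈ Δ, Real.exp (-(γ / 2) * (y 0 - m).natAbs))) *
          ((∫⁻ ω, f ω ∂P) * ∫⁻ ω, g ω ∂P) := by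
  refine ⟨|C| * ∑' x : Site d, Real.exp (-(γ / 2) * dist1 x 0),
    mul_nonneg (abs_nonneg C) (tsum_nonneg fun _ => (Real.exp_pos _).le),
    fun m Δ hΔ f g hf hg hfm hgΔ => ?_⟩
  obtain ⟨V, hΔV, hVm, hV⟩ := exists_finset_dist1_ge m fun y hy => by have := hΔ y hy; omega
  refine (lintegral_mul_le_of_mixingBound hmix hΔV (fun y hy x hx => ?_) hf hg
    (hfm.mono fun x hx hxV => ?_) hgΔ).trans ?_
  · have := hV y hy x hx
    have := hΔ y hy
    rw [dist1_comm]
    omega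
  · exact (hVm x hxV).not_gt hx
  · have hsum : ∀ y ∈ Δ, Summable fun x : ((V : Set (Site d))ᶜ : Set (Site d)) =>
        Real.exp (-γ * dist1 (x : Site d) y) := fun y _ => (summable_exp_dist1 hγ y).subtype _
    refine mul_le_mul_left (ENNReal.ofReal_le_ofReal (Real.exp_le_exp.mpr ?_)) _
    rw [mul_assoc, Summable.tsum_finsetSum hsum, Finset.mul_sum _ _ (∑' x : Site d, _)]
    gcongr with y hy
    · exact le_abs_self C
    · refine tsum_exp_dist1_le hγ fun x hx => ?_
      have := hV y hy x hx
      have := hΔ y hy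
      exact_mod_cast (by omega : (y 0 - m).natAbs ≤ dist1 x y)

end Decoupling

section Levels

/-- The sequence `X_n · e₁` of the levels of a path. -/
def height {d : ℕ} [NeZero d] (X : ℕ → Site d) : ℕ → ℤ := fun n => X n 0

/-- `t` is the time of the first visit to `m`, and no value above `m` is taken before. -/
def FirstHit (Z : ℕ → ℤ) (m : ℤ) (t : ℕ) : Prop := Z t = m ∧ ∀ s < t, Z s < m

/-- A good stretch of length `L` that is completed at time `s`: the sequence has risen by `L`,
without backtracking by `h`, and with at most `c (|j| + 1)²` visits to its start plus `j`. -/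
def goodUntil (h L c s : ℕ) : Set (ℕ → ℤ) :=
  {Z | FirstHit Z (Z 0 + L) s ∧ (∀ t ≤ s, Z 0 - h < Z t) ∧
    ∀ j : ℤ, Nat.count (fun t => Z t = Z 0 + j) s ≤ c * (j.natAbs + 1) ^ 2}

/-- The sequences that begin with a good stretch of length `L`. -/
def good (h L c : ℕ) : Set (ℕ → ℤ) := ⋃ s, goodUntil h L c s

/-- The sequences for which a good stretch begins at the first visit to `m`. -/
def goodFrom (h L c : ℕ) (m : ℤ) : Set (ℕ → ℤ) :=
  {Z | ∃ t, FirstHit Z m t ∧ after t Z ∈ good h L c}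

/-- The event `{R_c = ∞}` in terms of the levels of the path, for an integer `c`. -/
def escape (c : ℕ) : Set (ℕ → ℤ) :=
  {Z | (∀ n, 1 ≤ n → Z 0 < Z n) ∧
    ∀ j n : ℕ, Nat.count (fun t => Z t = Z 0 + j) n ≤ c * (j + 1) ^ 2}

theorem FirstHit.unique {Z : ℕ → ℤ} {m : ℤ} {s t : ℕ} (hs : FirstHit Z m s)
    (ht : FirstHit Z m t) : s = t := by
  by_contra hne
  rcases lt_or_gt_of_ne hne with h | h
  · exact (ht.2 s h).ne hs.1
  · exact (hs.2 t h).ne ht.1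

theorem count_congr_of_lt {p q : ℕ → Prop} [DecidablePred p] [DecidablePred q] {n : ℕ}
    (h : ∀ i < n, p i ↔ q i) : Nat.count p n = Nat.count q n := by
  rw [Nat.count_eq_card_filter_range, Nat.count_eq_card_filter_range]
  exact congrArg _ (Finset.filter_congr fun i hi => h i (Finset.mem_range.mp hi))

theorem FirstHit.congr {Z W : ℕ → ℤ} {m : ℤ} {t : ℕ} (h : ∀ i < t + 1, Z i = W i)
    (hZ : FirstHit Z m t) : FirstHit W m t :=
  ⟨h t (by omega) ▸ hZ.1, fun s hs => h s (by omega) ▸ hZ.2 s hs⟩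

theorem mem_goodUntil_congr {h L c s : ℕ} {Z W : ℕ → ℤ} (hZW : ∀ i < s + 1, Z i = W i)
    (hZ : Z ∈ goodUntil h L c s) : W ∈ goodUntil h L c s := by
  obtain ⟨hhit, hback, hcount⟩ := hZ
  rw [hZW 0 (by omega)] at hhit hback
  refine ⟨hhit.congr hZW, fun t ht => hZW t (by omega) ▸ hback t ht, fun j => ?_⟩
  refine (count_congr_of_lt fun i hi => ?_).trans_le (hcount j)
  rw [hZW i (by omega), hZW 0 (by omega)]

theorem dependsOn_goodUntil (h L c s : ℕ) :
    DependsOn (· ∈ goodUntil h L c s) (Set.Iio (s + 1)) := fun _ _ hZW =>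
  propext ⟨mem_goodUntil_congr hZW, mem_goodUntil_congr fun i hi => (hZW i hi).symm⟩

theorem measurableSet_good (h L c : ℕ) : MeasurableSet (good h L c) :=
  MeasurableSet.iUnion fun s => measurableSet_of_dependsOn (dependsOn_goodUntil h L c s)

theorem goodFrom_eq_iUnion (h L c : ℕ) (m : ℤ) :
    goodFrom h L c m = ⋃ t, {Z | FirstHit Z m t} ∩ after t ⁻¹' good h L c := by
  ext Z
  simp only [goodFrom, Set.mem_ofPred_eq, Set.mem_iUnion, Set.mem_inter_iff, Set.mem_preimage]

theorem pairwise_disjoint_goodUntil (h L c : ℕ) :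
    Pairwise (Function.onFun Disjoint (goodUntil h L c)) :=
  fun _ _ hst => Set.disjoint_left.mpr fun _ hs ht => hst (hs.1.unique ht.1)

theorem measurableSet_escape (c : ℕ) : MeasurableSet (escape c) := by
  have hrec : ∀ n, MeasurableSet {Z : ℕ → ℤ | 1 ≤ n → Z 0 < Z n} := fun n =>
    measurableSet_of_dependsOn (n := n + 1) fun Z W h => by
      simp only [Set.mem_ofPred_eq, h 0 (Set.mem_Iio.mpr (by omega)),
        h n (Set.mem_Iio.mpr (by omega))]
  have hcount : ∀ j n : ℕ,
      MeasurableSet {Z : ℕ → ℤ | Nat.count (fun t => Z t = Z 0 + j) n ≤ c * (j + 1) ^ 2} :=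
    fun j n => measurableSet_of_dependsOn (n := n + 1) fun Z W h => by
      simp only [Set.mem_ofPred_eq]
      rw [count_congr_of_lt fun i hi => by
        rw [h i (Set.mem_Iio.mpr (by omega)), h 0 (Set.mem_Iio.mpr (by omega))]]
  have : escape c = (⋂ n, {Z | 1 ≤ n → Z 0 < Z n}) ∩
      ⋂ j : ℕ, ⋂ n, {Z : ℕ → ℤ | Nat.count (fun t => Z t = Z 0 + j) n ≤ c * (j + 1) ^ 2} := by
    ext Z; simp only [escape, Set.mem_ofPred_eq, Set.mem_inter_iff, Set.mem_iInter]
  rw [this]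
  exact (MeasurableSet.iInter hrec).inter
    (MeasurableSet.iInter fun j => MeasurableSet.iInter (hcount j))

theorem preimage_add_const_good (h L c : ℕ) (a : ℤ) :
    (fun (Z : ℕ → ℤ) n => Z n + a) ⁻¹' good h L c = good h L c := by
  ext Z
  simp only [good, goodUntil, FirstHit, Set.mem_preimage, Set.mem_iUnion, Set.mem_ofPred_eq,
    add_right_comm _ a, add_sub_right_comm, add_left_inj, add_lt_add_iff_right]

theorem preimage_add_const_escape (c : ℕ) (a : ℤ) :
    (fun (Z : ℕ → ℤ) n => Z n + a) ⁻¹' escape c = escape c := by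
  ext Z
  simp only [escape, Set.mem_preimage, Set.mem_ofPred_eq, add_right_comm _ a, add_left_inj,
    add_lt_add_iff_right]

theorem count_lt_le_sum_of_mem_goodUntil {h L c s : ℕ} {Z : ℕ → ℤ} (hZ : Z ∈ goodUntil h L c s)
    (k : ℤ) : Nat.count (fun t => Z t < Z 0 + k) s ≤
      ∑ j ∈ Finset.Ioo (-(h : ℤ)) k, c * (j.natAbs + 1) ^ 2 := by
  have hsub : (Finset.range s).filter (fun t => Z t < Z 0 + k) ⊆
      (Finset.Ioo (-(h : ℤ)) k).biUnion fun j =>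
        (Finset.range s).filter fun t => Z t = Z 0 + j := by
    intro t ht
    simp only [Finset.mem_filter, Finset.mem_biUnion, Finset.mem_Ioo, Finset.mem_range] at ht ⊢
    have := hZ.2.1 t ht.1.le
    exact ⟨Z t - Z 0, ⟨by omega, by omega⟩, ht.1, by omega⟩
  rw [Nat.count_eq_card_filter_range]
  refine (Finset.card_le_card hsub).trans (Finset.card_biUnion_le.trans
    (Finset.sum_le_sum fun j _ => ?_))
  rw [← Nat.count_eq_card_filter_range]
  exact hZ.2.2 j

theorem sum_comp_le_tsum_of_mem_goodUntil {h L c s : ℕ} {Z : ℕ → ℤ} (hZ : Z ∈ goodUntil h L c s)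
    {f : ℤ → ℝ} (hf : ∀ j, 0 ≤ f j) (hsum : Summable fun j : ℤ => c * (j.natAbs + 1) ^ 2 * f j) :
    ∑ t ∈ Finset.range s, f (Z t - Z 0) ≤ ∑' j : ℤ, c * (j.natAbs + 1) ^ 2 * f j := by
  rw [Finset.sum_comp f fun t => Z t - Z 0]
  refine (Finset.sum_le_sum fun j _ => ?_).trans
    (hsum.sum_le_tsum _ fun j _ => mul_nonneg (by positivity) (hf j))
  rw [nsmul_eq_mul]
  refine mul_le_mul_of_nonneg_right ?_ (hf j)
  simp only [sub_eq_iff_eq_add']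
  rw [← Nat.count_eq_card_filter_range]
  exact_mod_cast hZ.2.2 j

end Levels

section Transience

theorem exists_le_forall_lt_of_tendsto_atTop {Z : ℕ → ℤ} (hZ : Tendsto Z atTop atTop) (a : ℤ) :
    ∃ n, a ≤ Z n ∧ ∀ t > n, Z n < Z t := by
  obtain ⟨N, hN⟩ := eventually_atTop.mp (hZ.eventually_ge_atTop a)
  have hfin : {t | Z t ≤ Z N}.Finite := by
    obtain ⟨M, hM⟩ := eventually_atTop.mp (hZ.eventually_gt_atTop (Z N))
    exact (Set.finite_Iio M).subset fun t ht => not_le.mp fun hMt => (hM t hMt).not_ge ht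
  obtain ⟨n, hn, hlast⟩ := hfin.exists_maximal ⟨N, le_refl (Z N)⟩
  have hNn : N ≤ n := by
    rcases le_total N n with h | h
    · exact h
    · exact hlast (le_refl (Z N)) h
  refine ⟨n, hN n hNn, fun t ht => lt_of_le_of_lt hn (not_le.mp fun hle => ?_)⟩
  exact (hlast hle ht.le).not_gt ht

theorem tendsto_atTop_of_finite_fibers {Z : ℕ → ℤ} {b : ℤ} (hb : ∀ t, b ≤ Z t)
    (hfin : ∀ k, {t | Z t = k}.Finite) : Tendsto Z atTop atTop := by
  refine tendsto_atTop.mpr fun a => ?_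
  have hlow : {t | Z t < a}.Finite := ((Set.finite_Ico b a).biUnion fun k _ => hfin k).subset
    fun t ht => Set.mem_iUnion₂.mpr ⟨Z t, ⟨hb t, ht⟩, rfl⟩
  rw [← Nat.cofinite_eq_atTop]
  filter_upwards [hlow.compl_mem_cofinite] with t ht using not_lt.mp ht

theorem finite_setOf_of_count_le {p : ℕ → Prop} [DecidablePred p] {B : ℕ}
    (hB : ∀ n, Nat.count p n ≤ B) : {t | p t}.Finite := by
  by_contra hinf
  obtain ⟨n, hn⟩ := Nat.surjective_count_of_infinite_setOfPred hinf (B + 1)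
  have := hB n
  omega

variable {h c : ℕ} {Z : ℕ → ℤ}

theorem exists_ge_mem_goodUntil_of_frequently (hZ : ∃ᶠ L in atTop, Z ∈ good h L c) (N : ℕ) :
    ∃ s ≥ N, ∃ L, Z ∈ goodUntil h L c s := by
  obtain ⟨B, hB⟩ := ((Finset.range N).image fun t => (Z t - Z 0).toNat).bddAbove
  obtain ⟨L, hL, hZL⟩ := frequently_atTop.mp hZ (B + 1)
  obtain ⟨s, hs⟩ := Set.mem_iUnion.mp hZL
  refine ⟨s, not_lt.mp fun hlt => ?_, L, hs⟩
  have := hB (Finset.mem_coe.mpr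
    (Finset.mem_image_of_mem (fun t => (Z t - Z 0).toNat) (Finset.mem_range.mpr hlt)))
  have := hs.1.1
  omega

theorem count_le_of_frequently_good (hZ : ∃ᶠ L in atTop, Z ∈ good h L c) (j : ℤ) (n : ℕ) :
    Nat.count (fun t => Z t = Z 0 + j) n ≤ c * (j.natAbs + 1) ^ 2 := by
  obtain ⟨s, hns, L, hs⟩ := exists_ge_mem_goodUntil_of_frequently hZ n
  exact (Nat.count_monotone _ hns).trans (hs.2.2 j)

theorem tendsto_atTop_of_frequently_good (hZ : ∃ᶠ L in atTop, Z ∈ good h L c) :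
    Tendsto Z atTop atTop := by
  refine tendsto_atTop_of_finite_fibers (b := Z 0 - h) (fun t => ?_) fun k =>
    finite_setOf_of_count_le (B := c * ((k - Z 0).natAbs + 1) ^ 2) fun n => ?_
  · obtain ⟨s, hts, L, hs⟩ := exists_ge_mem_goodUntil_of_frequently hZ t
    exact (hs.2.1 t hts).le
  · simpa only [add_sub_cancel] using count_le_of_frequently_good hZ (k - Z 0) n

theorem exists_after_mem_escape (hZ : ∃ᶠ L in atTop, Z ∈ good h L c) (a : ℤ) :
    ∃ n c', after n Z ∈ escape c' ∧ ∀ i, a ≤ after n Z i := by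
  obtain ⟨n, han, hn⟩ :=
    exists_le_forall_lt_of_tendsto_atTop (tendsto_atTop_of_frequently_good hZ) a
  refine ⟨n, c * ((Z n - Z 0).natAbs + 1) ^ 2, ⟨fun k hk => hn _ (by omega), fun j k => ?_⟩,
    fun i => ?_⟩
  · have hnatAbs : (Z n - Z 0 + j).natAbs + 1 ≤ ((Z n - Z 0).natAbs + 1) * (j + 1) := by
      have : (Z n - Z 0 + j).natAbs ≤ (Z n - Z 0).natAbs + j := by omega
      nlinarith [Nat.zero_le ((Z n - Z 0).natAbs * j)]
    calc Nat.count (fun t => after n Z t = Z n + j) k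
        ≤ Nat.count (fun t => Z t = Z n + j) (n + k) := by
          rw [Nat.count_add]; exact Nat.le_add_left _ _
      _ ≤ c * ((Z n - Z 0 + j).natAbs + 1) ^ 2 := by
          convert count_le_of_frequently_good hZ (Z n - Z 0 + j) (n + k) using 4
          ring
      _ ≤ c * (((Z n - Z 0).natAbs + 1) * (j + 1)) ^ 2 := by gcongr
      _ = c * ((Z n - Z 0).natAbs + 1) ^ 2 * (j + 1) ^ 2 := by ring
  · rcases i.eq_zero_or_pos with rfl | hi
    · exact han
    · exact han.trans (hn _ (by omega)).le

end Transience

section Environment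

variable {d : ℕ}

theorem stepKernel_apply_apply (ω : Env d) (y : Site d) (s : Set (Site d)) :
    stepKernel ω y s =
      ∑ v : steps d, ENNReal.ofReal (ω y v) * Measure.dirac (y + (v : Site d)) s := by
  change (∑ v : steps d, ENNReal.ofReal (ω y v) • Measure.dirac (y + (v : Site d))) s = _
  simp only [Measure.coe_finsetSum, Finset.sum_apply, Measure.smul_apply, smul_eq_mul]

theorem stepKernel_congr {ω ω' : Env d} {y : Site d} (h : ω y = ω' y) :
    stepKernel ω y = stepKernel ω' y :=
  Measure.ext fun s _ => by simp only [stepKernel_apply_apply, h]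

theorem stepKernel_shift (x : Site d) (ω : Env d) (y z : Site d) :
    stepKernel ω (y + x) {z + x} = stepKernel (shift x ω) y {z} := by
  simp only [stepKernel_apply_apply]
  refine Finset.sum_congr rfl fun v _ => ?_
  rw [Measure.dirac_apply' _ .of_discrete, Measure.dirac_apply' _ .of_discrete]
  simp only [Set.indicator_apply, Set.mem_singleton_iff, add_right_comm y x, add_left_inj]
  rfl

/-- The uniform distribution on the steps. -/
noncomputable def uniformLaw (d : ℕ) : StepLaw d :=
  ⟨fun _ => (Fintype.card (steps d) : ℝ)⁻¹, fun _ => by positivity, by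
    rw [Finset.sum_const, Finset.card_univ, nsmul_eq_mul,
      mul_inv_cancel₀ (Nat.cast_ne_zero.mpr Fintype.card_ne_zero)]⟩

theorem stepKernel_le_of_eq_uniformLaw (ω : Env d) {ω' : Env d} {y : Site d}
    (h : ω' y = uniformLaw d) (s : Set (Site d)) :
    stepKernel ω y s ≤ (Fintype.card (steps d) : ℝ≥0∞) * stepKernel ω' y s := by
  have hcard : (Fintype.card (steps d) : ℝ) ≠ 0 := Nat.cast_ne_zero.mpr Fintype.card_ne_zero
  rw [stepKernel_apply_apply, stepKernel_apply_apply, Finset.mul_sum]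
  refine Finset.sum_le_sum fun v _ => ?_
  have huniform : (Fintype.card (steps d) : ℝ≥0∞) * ENNReal.ofReal (ω' y v) = 1 := by
    rw [h]
    change _ * ENNReal.ofReal (Fintype.card (steps d) : ℝ)⁻¹ = 1
    rw [← ENNReal.ofReal_natCast, ← ENNReal.ofReal_mul (by positivity), mul_inv_cancel₀ hcard,
      ENNReal.ofReal_one]
  have hle : ω y v ≤ 1 := (ω y).2.2 ▸
    Finset.single_le_sum (f := fun v => ω y v) (fun v _ => (ω y).2.1 v) (Finset.mem_univ v)
  rw [← mul_assoc, huniform]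
  gcongr
  exact ENNReal.ofReal_le_one.mpr hle

theorem measurable_pathWeight_stepKernel (n : ℕ) (π : ℕ → Site d) :
    Measurable fun ω : Env d => pathWeight (stepKernel ω) n π :=
  Finset.measurable_prod _ fun i _ =>
    (Measure.measurable_coe (.singleton _)).comp (measurable_stepKernel (π i))

theorem dependsOn_pathWeight_stepKernel {n : ℕ} {π : ℕ → Site d} {Λ : Set (Site d)}
    (hπ : ∀ i < n, π i ∈ Λ) : DependsOn (fun ω : Env d => pathWeight (stepKernel ω) n π) Λ :=
  fun _ _ h => pathWeight_congr (fun _ _ => rfl) fun i hi => stepKernel_congr (h _ (hπ i hi))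

variable [NeZero d]

/-- The environment `ω` with uniform transition probabilities below the level `k`. -/
noncomputable def uniformBelow (k : ℤ) (ω : Env d) : Env d :=
  fun x => if k ≤ x 0 then ω x else uniformLaw d

theorem measurable_uniformBelow (k : ℤ) : Measurable (uniformBelow (d := d) k) := by
  refine measurable_pi_lambda _ fun x => ?_
  by_cases h : k ≤ x 0
  · simpa only [uniformBelow, if_pos h] using measurable_pi_apply _
  · simpa only [uniformBelow, if_neg h] using measurable_const

theorem pathWeight_le_uniformBelow (ω : Env d) (k : ℤ) (s : ℕ) (π : ℕ → Site d) :
    pathWeight (stepKernel ω) s π ≤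
      (Fintype.card (steps d) : ℝ≥0∞) ^ Nat.count (fun t => height π t < k) s *
        pathWeight (stepKernel (uniformBelow k ω)) s π := by
  have hstep : ∀ t, stepKernel ω (π t) {π (t + 1)} ≤
      (if height π t < k then (Fintype.card (steps d) : ℝ≥0∞) else 1) *
        stepKernel (uniformBelow k ω) (π t) {π (t + 1)} := fun t => by
    split_ifs with ht
    · exact stepKernel_le_of_eq_uniformLaw ω (if_neg ht.not_ge) _
    · have hω : uniformBelow k ω (π t) = ω (π t) := if_pos (not_lt.mp ht)
      rw [one_mul, stepKernel_congr hω]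
  refine (Finset.prod_le_prod' fun t _ => hstep t).trans_eq ?_
  rw [Finset.prod_mul_distrib, Finset.prod_ite, Finset.prod_const, Finset.prod_const_one, mul_one,
    Nat.count_eq_card_filter_range, pathWeight]

theorem dependsOn_pathWeight_uniformBelow {k : ℤ} {n : ℕ} {π : ℕ → Site d} {Λ : Set (Site d)}
    (hπ : ∀ i < n, k ≤ height π i → π i ∈ Λ) :
    DependsOn (fun ω : Env d => pathWeight (stepKernel (uniformBelow k ω)) n π) Λ := by
  refine fun ω ω' h => pathWeight_congr (fun _ _ => rfl) fun i hi => stepKernel_congr ?_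
  simp only [uniformBelow]
  split_ifs with hk
  · exact h _ (hπ i hi hk)
  · rfl

theorem measurable_height : Measurable (height (d := d)) :=
  measurable_pi_lambda _ fun n => (measurable_pi_apply 0).comp (measurable_pi_apply n)

theorem dependsOn_preimage_height {A : Set (ℕ → ℤ)} {s : Set ℕ} (hA : DependsOn (· ∈ A) s) :
    DependsOn (· ∈ height (d := d) ⁻¹' A) s := fun _ _ h =>
  hA fun i hi => congrArg (· 0) (h i hi)

end Environment

section PathLaw

variable {d : ℕ}

/-- The annealed law of the path of the walk started at `x` when the environment has law `μ`. -/
noncomputable def pathLaw (μ : Measure (Env d)) (x : Site d) : Measure (ℕ → Site d) :=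
  μ.bind (quenchedLaw x)

theorem pathLaw_apply (μ : Measure (Env d)) (x : Site d) {B : Set (ℕ → Site d)}
    (hB : MeasurableSet B) : pathLaw μ x B = ∫⁻ ω, chainLaw (stepKernel ω) x B ∂μ :=
  Measure.bind_apply hB (measurable_quenchedLaw x).aemeasurable

theorem measurable_chainLaw_stepKernel (x : Site d) {B : Set (ℕ → Site d)} (hB : MeasurableSet B) :
    Measurable fun ω : Env d => chainLaw (stepKernel ω) x B :=
  (Measure.measurable_coe hB).comp (measurable_quenchedLaw x)

theorem pathLaw_map_apply {f : Env d → Env d} (hf : Measurable f) (μ : Measure (Env d))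
    (x : Site d) {B : Set (ℕ → Site d)} (hB : MeasurableSet B) :
    pathLaw (μ.map f) x B = ∫⁻ ω, chainLaw (stepKernel (f ω)) x B ∂μ := by
  rw [pathLaw_apply _ _ hB, lintegral_map (measurable_chainLaw_stepKernel x hB) hf]

theorem pathLaw_eq_zero_iff (μ : Measure (Env d)) (x : Site d) {B : Set (ℕ → Site d)}
    (hB : MeasurableSet B) : pathLaw μ x B = 0 ↔ ∀ᵐ ω ∂μ, chainLaw (stepKernel ω) x B = 0 := by
  rw [pathLaw_apply μ x hB, lintegral_eq_zero_iff (measurable_chainLaw_stepKernel x hB)]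
  rfl

theorem pathLaw_map_shift (μ : Measure (Env d)) (y : Site d) :
    (pathLaw (μ.map (shift y)) 0).map (fun X n => X n + y) = pathLaw μ y := by
  have hadd : Measurable fun (X : ℕ → Site d) n => X n + y :=
    measurable_pi_lambda _ fun n =>
      (Measurable.of_discrete (f := (· + y))).comp (measurable_pi_apply n)
  have hshift : Measurable (shift y : Env d → Env d) :=
    measurable_pi_lambda _ fun x => measurable_pi_apply (x + y)
  have hchain : ∀ ω : Env d,
      (chainLaw (stepKernel (shift y ω)) 0).map (fun X n => X n + y) = chainLaw (stepKernel ω) y :=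
    fun ω => by
      simpa only [Equiv.coe_addRight, zero_add] using
        chainLaw_map_equiv (Equiv.addRight y) (stepKernel_shift y ω) 0
  refine Measure.ext fun B hB => ?_
  rw [Measure.map_apply hadd hB, pathLaw_map_apply hshift μ 0 (hadd hB), pathLaw_apply μ y hB]
  simp only [← hchain, Measure.map_apply hadd hB]

instance (μ : Measure (Env d)) [IsProbabilityMeasure μ] (x : Site d) :
    IsProbabilityMeasure (pathLaw μ x) :=
  ⟨by rw [pathLaw_apply μ x .univ]; simp only [measure_univ, lintegral_const, mul_one]⟩

theorem pathLaw_cylinder (μ : Measure (Env d)) (x : Site d) (n : ℕ) (π : ℕ → Site d) :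
    pathLaw μ x (PiNat.cylinder π (n + 1)) =
      Measure.dirac x {π 0} * ∫⁻ ω, pathWeight (stepKernel ω) n π ∂μ := by
  simp only [pathLaw_apply μ x (measurableSet_cylinder _ _), chainLaw_cylinder]
  exact lintegral_const_mul' _ _ (measure_ne_top _ _)

theorem pathLaw_cylinder_inter_after_cylinder (μ : Measure (Env d)) (x : Site d) (n s : ℕ)
    (π σ : ℕ → Site d) :
    pathLaw μ x (PiNat.cylinder π (n + 1) ∩ after n ⁻¹' PiNat.cylinder σ (s + 1)) =
      Measure.dirac x {π 0} * (Measure.dirac (π n) {σ 0} *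
        ∫⁻ ω, pathWeight (stepKernel ω) n π * pathWeight (stepKernel ω) s σ ∂μ) := by
  have hσ := measurableSet_cylinder σ (s + 1)
  rw [pathLaw_apply μ x ((measurableSet_cylinder _ _).inter (measurable_after n hσ))]
  simp only [chainLaw_cylinder_inter_after _ _ _ _ hσ, chainLaw_cylinder]
  rw [← lintegral_const_mul' _ _ (measure_ne_top _ _),
    ← lintegral_const_mul' _ _ (measure_ne_top _ _)]
  exact lintegral_congr fun ω => by ring

end PathLaw

section Decoupling

variable {d : ℕ} [NeZero d] {P : Measure (Env d)} [IsProbabilityMeasure P] {r : ℕ} {γ C : ℝ}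

theorem summable_sq_mul_exp_natAbs (c : ℕ) {a : ℝ} (ha : 0 < a) :
    Summable fun j : ℤ => (c : ℝ) * (j.natAbs + 1) ^ 2 * Real.exp (-a * j.natAbs) := by
  have hpow : ∀ k : ℕ, Summable fun j : ℕ => (j : ℝ) ^ k * Real.exp (-a * j) := fun k =>
    Real.summable_pow_mul_exp_neg_nat_mul k ha
  have hnat : Summable fun j : ℕ => (c : ℝ) * (j + 1) ^ 2 * Real.exp (-a * j) := by
    refine (((hpow 2).add (((hpow 1).mul_left 2).add (hpow 0))).mul_left (c : ℝ)).congr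
      fun j => ?_
    ring
  exact .of_nat_of_neg (by simpa only [Int.natAbs_natCast] using hnat)
    (by simpa only [Int.natAbs_neg, Int.natAbs_natCast] using hnat)

theorem sum_exp_le_tsum_of_mem_goodUntil {h L c s : ℕ} {σ : ℕ → Site d}
    (hσ : height σ ∈ goodUntil h L c s) {a : ℝ} (ha : 0 < a) {Δ : Finset (Site d)}
    (hΔ : ∀ y ∈ Δ, ∃ t < s, σ t = y) :
    ∑ y ∈ Δ, Real.exp (-a * (y 0 - σ 0 0).natAbs) ≤
      ∑' j : ℤ, (c : ℝ) * (j.natAbs + 1) ^ 2 * Real.exp (-a * j.natAbs) := by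
  classical
  have hsub : Δ ⊆ (Finset.range s).image σ := fun y hy => by
    obtain ⟨t, hts, rfl⟩ := hΔ y hy
    exact Finset.mem_image_of_mem σ (Finset.mem_range.mpr hts)
  calc ∑ y ∈ Δ, Real.exp (-a * (y 0 - σ 0 0).natAbs)
      ≤ ∑ y ∈ (Finset.range s).image σ, Real.exp (-a * (y 0 - σ 0 0).natAbs) :=
        Finset.sum_le_sum_of_subset_of_nonneg hsub fun _ _ _ => (Real.exp_pos _).le
    _ ≤ ∑ t ∈ Finset.range s, Real.exp (-a * (height σ t - height σ 0).natAbs) :=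
        Finset.sum_image_le_of_nonneg (f := fun y : Site d =>
          Real.exp (-a * (y 0 - σ 0 0).natAbs)) fun _ _ => (Real.exp_pos _).le
    _ ≤ _ := sum_comp_le_tsum_of_mem_goodUntil hσ (f := fun j => Real.exp (-a * j.natAbs))
        (fun _ => (Real.exp_pos _).le) (summable_sq_mul_exp_natAbs c ha)

theorem exists_lintegral_pathWeight_mul_le (hγ : 0 < γ) (hmix : MixingBound P r γ C) (h c : ℕ) :
    ∃ K : ℝ≥0∞, K ≠ ∞ ∧ ∀ (n s L : ℕ) (π σ : ℕ → Site d), (∀ i < n, height π i < height π n) →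
      σ 0 = π n → height σ ∈ goodUntil h L c s →
      ∫⁻ ω, pathWeight (stepKernel ω) n π *
          pathWeight (stepKernel (uniformBelow (π n 0 + r) ω)) s σ ∂P ≤
        K * ((∫⁻ ω, pathWeight (stepKernel ω) n π ∂P) *
          ∫⁻ ω, pathWeight (stepKernel (uniformBelow (π n 0 + r) ω)) s σ ∂P) := by
  classical
  obtain ⟨T, hT, hdecouple⟩ := exists_lintegral_mul_le_of_mixingBound hγ hmix
  refine ⟨ENNReal.ofReal (Real.exp (T * ∑' j : ℤ, (c : ℝ) * (j.natAbs + 1) ^ 2 *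
    Real.exp (-(γ / 2) * j.natAbs))), ENNReal.ofReal_ne_top, fun n s L π σ hπ hσπ hσ => ?_⟩
  set Δ : Finset (Site d) := ((Finset.range s).image σ).filter fun y => π n 0 + r ≤ y 0
  have hΔσ : ∀ y ∈ Δ, ∃ t < s, σ t = y := fun y hy => by
    simpa only [Finset.mem_image, Finset.mem_range] using (Finset.mem_filter.mp hy).1
  refine (hdecouple (π n 0) Δ (fun y hy => (Finset.mem_filter.mp hy).2) _ _
    (measurable_pathWeight_stepKernel n π)
    ((measurable_pathWeight_stepKernel s σ).comp (measurable_uniformBelow _))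
    (dependsOn_pathWeight_stepKernel hπ)
    (dependsOn_pathWeight_uniformBelow fun i hi hk => ?_)).trans ?_
  · exact Finset.mem_coe.mpr (Finset.mem_filter.mpr
      ⟨Finset.mem_image_of_mem σ (Finset.mem_range.mpr hi), hk⟩)
  · refine mul_le_mul_left (ENNReal.ofReal_le_ofReal (Real.exp_le_exp.mpr ?_)) _
    refine mul_le_mul_of_nonneg_left ?_ hT
    rw [← hσπ]
    exact sum_exp_le_tsum_of_mem_goodUntil hσ (half_pos hγ) hΔσ

theorem exists_lintegral_pathWeight_mul_le_uniformBelow (hγ : 0 < γ) (hmix : MixingBound P r γ C)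
    (h c : ℕ) :
    ∃ K : ℝ≥0∞, K ≠ ∞ ∧ ∀ (n s L : ℕ) (π σ : ℕ → Site d), (∀ i < n, height π i < height π n) →
      σ 0 = π n → height σ ∈ goodUntil h L c s →
      ∫⁻ ω, pathWeight (stepKernel ω) n π * pathWeight (stepKernel ω) s σ ∂P ≤
        K * ((∫⁻ ω, pathWeight (stepKernel ω) n π ∂P) *
          ∫⁻ ω, pathWeight (stepKernel (uniformBelow (π n 0 + r) ω)) s σ ∂P) := by
  obtain ⟨K, hK, hdecouple⟩ := exists_lintegral_pathWeight_mul_le hγ hmix h c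
  set N : ℝ≥0∞ := (Fintype.card (steps d) : ℝ≥0∞) ^
    ∑ j ∈ Finset.Ioo (-(h : ℤ)) r, c * (j.natAbs + 1) ^ 2
  have hN : N ≠ ∞ := ENNReal.pow_ne_top (ENNReal.natCast_ne_top _)
  refine ⟨N * K, ENNReal.mul_ne_top hN hK, fun n s L π σ hπ hσπ hσ => ?_⟩
  have hweight : ∀ ω : Env d, pathWeight (stepKernel ω) s σ ≤
      N * pathWeight (stepKernel (uniformBelow (π n 0 + r) ω)) s σ := fun ω => by
    refine (pathWeight_le_uniformBelow ω (π n 0 + r) s σ).trans ?_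
    refine mul_le_mul_left (pow_le_pow_right₀ ?_ ?_) _
    · exact Nat.one_le_cast.mpr (Nat.one_le_iff_ne_zero.mpr Fintype.card_ne_zero)
    · rw [← hσπ]
      exact count_lt_le_sum_of_mem_goodUntil hσ r
  calc ∫⁻ ω, pathWeight (stepKernel ω) n π * pathWeight (stepKernel ω) s σ ∂P
      ≤ ∫⁻ ω, N * (pathWeight (stepKernel ω) n π *
          pathWeight (stepKernel (uniformBelow (π n 0 + r) ω)) s σ) ∂P :=
        lintegral_mono fun ω => (mul_le_mul_right (hweight ω) _).trans_eq (mul_left_comm _ _ _)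
    _ ≤ _ := by
        rw [lintegral_const_mul' _ _ hN, mul_assoc]
        gcongr
        exact hdecouple n s L π σ hπ hσπ hσ

theorem exists_pathLaw_inter_after_cylinder_le (hγ : 0 < γ) (hmix : MixingBound P r γ C)
    (h c : ℕ) :
    ∃ K : ℝ≥0∞, K ≠ ∞ ∧ ∀ (x : Site d) (n s L : ℕ) (π σ : ℕ → Site d),
      (∀ i < n, height π i < height π n) → height σ ∈ goodUntil h L c s →
      pathLaw P x (PiNat.cylinder π (n + 1) ∩ after n ⁻¹' PiNat.cylinder σ (s + 1)) ≤
        K * pathLaw P x (PiNat.cylinder π (n + 1)) *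
          pathLaw (P.map (uniformBelow (π n 0 + r))) (π n) (PiNat.cylinder σ (s + 1)) := by
  obtain ⟨K, hK, hweight⟩ := exists_lintegral_pathWeight_mul_le_uniformBelow hγ hmix h c
  refine ⟨K, hK, fun x n s L π σ hπ hσ => ?_⟩
  rw [pathLaw_cylinder_inter_after_cylinder, pathLaw_cylinder, pathLaw_cylinder,
    lintegral_map (measurable_pathWeight_stepKernel s σ) (measurable_uniformBelow _)]
  by_cases h0 : π n = σ 0
  · calc _ ≤ Measure.dirac x {π 0} * (Measure.dirac (π n) {σ 0} *
          (K * ((∫⁻ ω, pathWeight (stepKernel ω) n π ∂P) *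
            ∫⁻ ω, pathWeight (stepKernel (uniformBelow (π n 0 + r) ω)) s σ ∂P))) := by
          gcongr
          exact hweight n s L π σ hπ h0.symm hσ
      _ = _ := by ring
  · rw [Measure.dirac_apply' (π n) .of_discrete,
      Set.indicator_of_notMem (Set.mem_singleton_iff.not.mpr h0)]
    simp only [zero_mul, mul_zero, le_refl]

theorem exists_pathLaw_inter_after_good_le (hγ : 0 < γ) (hmix : MixingBound P r γ C) (h c : ℕ) :
    ∃ K : ℝ≥0∞, K ≠ ∞ ∧ ∀ (x : Site d) (n L : ℕ) (π : ℕ → Site d),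
      (∀ i < n, height π i < height π n) →
      pathLaw P x (PiNat.cylinder π (n + 1) ∩ after n ⁻¹' (height ⁻¹' good h L c)) ≤
        K * pathLaw P x (PiNat.cylinder π (n + 1)) *
          pathLaw (P.map (uniformBelow (π n 0 + r))) (π n) (height ⁻¹' good h L c) := by
  obtain ⟨K, hK, hcylinder⟩ := exists_pathLaw_inter_after_cylinder_le hγ hmix h c
  refine ⟨K, hK, fun x n L π hπ => ?_⟩
  set μ : Measure (ℕ → Site d) :=
    ((pathLaw P x).restrict (PiNat.cylinder π (n + 1))).map (after n) with hμ
  set ν : Measure (ℕ → Site d) := pathLaw (P.map (uniformBelow (π n 0 + r))) (π n)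
  have hgood : ∀ s, MeasurableSet (height (d := d) ⁻¹' goodUntil h L c s) := fun s =>
    measurable_height (measurableSet_of_dependsOn (dependsOn_goodUntil h L c s))
  have hμ_apply : ∀ {B}, MeasurableSet B →
      μ B = pathLaw P x (PiNat.cylinder π (n + 1) ∩ after n ⁻¹' B) := fun hB => by
    rw [hμ, Measure.map_apply (measurable_after n) hB,
      Measure.restrict_apply (measurable_after n hB), Set.inter_comm]
  have hpiece : ∀ s, μ (height ⁻¹' goodUntil h L c s) ≤
      ((K * pathLaw P x (PiNat.cylinder π (n + 1))) • ν) (height ⁻¹' goodUntil h L c s) :=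
    fun s => measure_le_of_cylinder (dependsOn_preimage_height (dependsOn_goodUntil h L c s))
      fun σ hσ => by
        rw [hμ_apply (measurableSet_cylinder _ _)]
        exact hcylinder x n s L π σ hπ hσ
  rw [← hμ_apply (measurable_height (measurableSet_good h L c)), ← smul_eq_mul (_ * _),
    ← Measure.smul_apply, good, Set.preimage_iUnion]
  exact (measure_iUnion_le _).trans ((ENNReal.tsum_le_tsum hpiece).trans_eq (measure_iUnion
    (fun _ _ hst => (pairwise_disjoint_goodUntil h L c hst).preimage height) hgood).symm)

end Decoupling

section RareStretches

/-- At a record, the future of the sequence lies in `G` with conditional probability at most `ε`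
given the past; the pasts are the events determined up to the time of the record. -/
def RareAfterRecords (μ : Measure (ℕ → ℤ)) (G : Set (ℕ → ℤ)) (ε : ℝ≥0∞) : Prop :=
  ∀ (n : ℕ) (A : Set (ℕ → ℤ)), DependsOn (· ∈ A) (Set.Iio (n + 1)) →
    (∀ Z ∈ A, ∀ i < n, Z i < Z n) → μ (A ∩ after n ⁻¹' G) ≤ ε * μ A

variable {d : ℕ} [NeZero d] {P : Measure (Env d)}

theorem pathLaw_preimage_height_map_shift (μ : Measure (Env d)) (y : Site d) {A : Set (ℕ → ℤ)}
    (hA : MeasurableSet A) (hadd : ∀ a : ℤ, (fun (Z : ℕ → ℤ) n => Z n + a) ⁻¹' A = A) :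
    pathLaw (μ.map (shift y)) 0 (height ⁻¹' A) = pathLaw μ y (height ⁻¹' A) := by
  have hmeas : Measurable fun (X : ℕ → Site d) n => X n + y := measurable_pi_lambda _ fun n =>
    (Measurable.of_discrete (f := (· + y))).comp (measurable_pi_apply n)
  rw [← pathLaw_map_shift μ y, Measure.map_apply hmeas (measurable_height hA)]
  exact congrArg _ (congrArg (height ⁻¹' ·) (hadd (y 0))).symm

theorem pathLaw_uniformBelow_preimage_height (hinv : TranslationInvariant P) (k : ℤ) (y : Site d)
    {A : Set (ℕ → ℤ)} (hA : MeasurableSet A)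
    (hadd : ∀ a : ℤ, (fun (Z : ℕ → ℤ) n => Z n + a) ⁻¹' A = A) :
    pathLaw (P.map (uniformBelow (y 0 + k))) y (height ⁻¹' A) =
      pathLaw (P.map (uniformBelow k)) 0 (height ⁻¹' A) := by
  have hcomm : shift y ∘ uniformBelow (d := d) (y 0 + k) = uniformBelow k ∘ shift y := by
    ext1 ω; ext1 x
    simp only [Function.comp_apply, shift, uniformBelow, Pi.add_apply, add_comm (y 0),
      add_le_add_iff_right]
  rw [← pathLaw_preimage_height_map_shift _ y hA hadd,
    Measure.map_map (hinv y).measurable (measurable_uniformBelow _), hcomm,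
    ← Measure.map_map (measurable_uniformBelow k) (hinv y).measurable, (hinv y).map_eq]

theorem pathLaw_escape_eq_zero (hinv : TranslationInvariant P) {c : ℕ}
    (hnull : pathLaw P 0 (height ⁻¹' escape c) = 0) (y : Site d) :
    pathLaw P y (height ⁻¹' escape c) = 0 := by
  rw [← pathLaw_preimage_height_map_shift P y (measurableSet_escape c)
    (preimage_add_const_escape c), (hinv y).map_eq, hnull]

theorem pathLaw_uniformBelow_after_escape_eq_zero (hinv : TranslationInvariant P) {c : ℕ}
    (hnull : pathLaw P 0 (height ⁻¹' escape c) = 0) (k : ℤ) (x : Site d) (n : ℕ) :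
    pathLaw (P.map (uniformBelow k)) x
      (after n ⁻¹' (height ⁻¹' escape c ∩ {X | ∀ i, X i ∈ {y : Site d | k ≤ y 0}})) = 0 := by
  have hescape : MeasurableSet (height (d := d) ⁻¹' escape c) :=
    measurable_height (measurableSet_escape c)
  have habove : MeasurableSet {X : ℕ → Site d | ∀ i, X i ∈ {y : Site d | k ≤ y 0}} := by
    rw [Set.ofPred_forall]
    exact .iInter fun i => measurable_pi_apply i .of_discrete
  have hquenched : ∀ᵐ ω ∂P, ∀ z, chainLaw (stepKernel ω) z (height ⁻¹' escape c) = 0 :=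
    ae_all_iff.mpr fun z =>
      (pathLaw_eq_zero_iff P z hescape).mp (pathLaw_escape_eq_zero hinv hnull z)
  rw [pathLaw_map_apply (measurable_uniformBelow k) _ _
    (measurable_after n (hescape.inter habove))]
  refine lintegral_eq_zero_of_ae_eq_zero ?_
  filter_upwards [hquenched] with ω hω
  refine chainLaw_preimage_after_null _ (hescape.inter habove) (fun z => ?_) x n
  have hagree : ∀ y ∈ {y : Site d | k ≤ y 0},
      stepKernel (uniformBelow k ω) y = stepKernel ω y := fun y hy => stepKernel_congr (if_pos hy)
  rw [chainLaw_inter_forall_mem hagree z hescape]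
  exact measure_mono_null Set.inter_subset_left (hω z)

theorem ae_eventually_notMem_good (hinv : TranslationInvariant P)
    (hnull : ∀ c, pathLaw P 0 (height ⁻¹' escape c) = 0) (k : ℤ) (x : Site d) (h c : ℕ) :
    ∀ᵐ X ∂pathLaw (P.map (uniformBelow k)) x, ∀ᶠ L in atTop, height X ∉ good h L c := by
  have hae : ∀ᵐ X ∂pathLaw (P.map (uniformBelow k)) x, ∀ n c',
      X ∉ after n ⁻¹' (height ⁻¹' escape c' ∩ {X | ∀ i, X i ∈ {y : Site d | k ≤ y 0}}) :=
    ae_all_iff.mpr fun n => ae_all_iff.mpr fun c' => measure_eq_zero_iff_ae_notMem.mp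
      (pathLaw_uniformBelow_after_escape_eq_zero hinv (hnull c') k x n)
  filter_upwards [hae] with X hX
  by_contra hgood
  have hfreq : ∃ᶠ L in atTop, height X ∈ good h L c := hgood
  obtain ⟨n, c', hescape, habove⟩ := exists_after_mem_escape hfreq k
  exact hX n c' ⟨hescape, habove⟩

variable [IsProbabilityMeasure P]

theorem tendsto_pathLaw_uniformBelow_good (hinv : TranslationInvariant P)
    (hnull : ∀ c, pathLaw P 0 (height ⁻¹' escape c) = 0) (k : ℤ) (x : Site d) (h c : ℕ) :
    Tendsto (fun L => pathLaw (P.map (uniformBelow k)) x (height ⁻¹' good h L c)) atTop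
      (nhds 0) := by
  have : IsProbabilityMeasure (P.map (uniformBelow k)) :=
    Measure.isProbabilityMeasure_map (measurable_uniformBelow k).aemeasurable
  rw [← measure_empty (μ := pathLaw (P.map (uniformBelow k)) x)]
  refine tendsto_measure_of_ae_tendsto_indicator_of_isFiniteMeasure atTop .empty
    (fun L => measurable_height (measurableSet_good h L c)) ?_
  filter_upwards [ae_eventually_notMem_good hinv hnull k x h c] with X hX
  filter_upwards [hX] with L hL
  exact iff_of_false hL (Set.notMem_empty X)

theorem eventually_rareAfterRecords_good (hinv : TranslationInvariant P) {r : ℕ}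
    {γ C : ℝ} (hγ : 0 < γ) (hmix : MixingBound P r γ C)
    (hnull : ∀ c, pathLaw P 0 (height ⁻¹' escape c) = 0) (x : Site d) (h c : ℕ) {ε : ℝ≥0∞}
    (hε : 0 < ε) :
    ∀ᶠ L in atTop, RareAfterRecords ((pathLaw P x).map height) (good h L c) ε := by
  obtain ⟨K, hK, hle⟩ := exists_pathLaw_inter_after_good_le hγ hmix h c
  filter_upwards [(tendsto_pathLaw_uniformBelow_good hinv hnull r 0 h c).eventually
    (ge_mem_nhds (ENNReal.div_pos hε.ne' hK))] with L hL n A hA hrecord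
  have hgood := measurable_after n (measurableSet_good h L c)
  have hAm : MeasurableSet A := measurableSet_of_dependsOn hA
  rw [Measure.map_apply measurable_height (hAm.inter hgood),
    Measure.map_apply measurable_height hAm, Set.preimage_inter,
    ← Measure.restrict_apply' (measurable_height hgood), ← smul_eq_mul, ← Measure.smul_apply]
  refine measure_le_of_cylinder (dependsOn_preimage_height hA) fun π hπ => ?_
  rw [Measure.restrict_apply' (measurable_height hgood), Measure.smul_apply, smul_eq_mul]
  calc pathLaw P x (PiNat.cylinder π (n + 1) ∩ after n ⁻¹' (height ⁻¹' good h L c))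
      ≤ K * pathLaw P x (PiNat.cylinder π (n + 1)) *
          pathLaw (P.map (uniformBelow (π n 0 + r))) (π n) (height ⁻¹' good h L c) :=
        hle x n L π (hrecord _ hπ)
    _ ≤ K * pathLaw P x (PiNat.cylinder π (n + 1)) * (ε / K) := by
        rw [pathLaw_uniformBelow_preimage_height hinv r (π n) (measurableSet_good h L c)
          (preimage_add_const_good h L c)]
        gcongr
    _ = K * (ε / K) * pathLaw P x (PiNat.cylinder π (n + 1)) := by ring
    _ ≤ ε * pathLaw P x (PiNat.cylinder π (n + 1)) := by gcongr; exact ENNReal.mul_div_le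

end RareStretches

section SeparatedStretches

variable {h L c : ℕ} {S : Finset ℕ} {m : ℕ}

theorem FirstHit.add_lt_of_mem_goodUntil {Z : ℕ → ℤ} {a b : ℤ} {s t u : ℕ} (ht : FirstHit Z a t)
    (hs : after t Z ∈ goodUntil h L c s) (hu : FirstHit Z b u) (hab : a + L ≤ b) : t + s ≤ u := by
  have hreach : Z (t + s) = a + L := ht.1 ▸ hs.1.1
  by_contra! hlt
  rcases lt_or_ge u t with hut | htu
  · have := ht.2 u hut
    have := hu.1
    omega
  · have hbelow : Z (t + (u - t)) < Z t + L := hs.1.2 (u - t) (by omega)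
    rw [Nat.add_sub_cancel' htu, hu.1, ht.1] at hbelow
    omega

theorem dependsOn_biInter_goodFrom_inter_firstHit (hS : ∀ k ∈ S, k + L ≤ m) (u : ℕ) :
    DependsOn (· ∈ (⋂ k ∈ S, goodFrom h L c k) ∩ {Z | FirstHit Z m u}) (Set.Iio (u + 1)) := by
  suffices ∀ Z W : ℕ → ℤ, (∀ i < u + 1, Z i = W i) →
      Z ∈ (⋂ k ∈ S, goodFrom h L c k) ∩ {Z | FirstHit Z m u} →
      W ∈ (⋂ k ∈ S, goodFrom h L c k) ∩ {Z | FirstHit Z m u} from fun Z W hZW =>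
    propext ⟨this Z W hZW, this W Z fun i hi => (hZW i hi).symm⟩
  rintro Z W hZW ⟨hZ, hu⟩
  refine ⟨Set.mem_iInter₂.mpr fun k hk => ?_, hu.congr hZW⟩
  obtain ⟨t, ht, hgood⟩ := Set.mem_iInter₂.mp hZ k hk
  obtain ⟨s, hs⟩ := Set.mem_iUnion.mp hgood
  have htsu : t + s ≤ u := ht.add_lt_of_mem_goodUntil hs hu (by exact_mod_cast hS k hk)
  exact ⟨t, ht.congr fun i hi => hZW i (by omega), Set.mem_iUnion.mpr
    ⟨s, mem_goodUntil_congr (fun i hi => hZW _ (by omega)) hs⟩⟩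

variable {μ : Measure (ℕ → ℤ)} {ε : ℝ≥0∞}

theorem RareAfterRecords.measure_goodFrom_inter_biInter_le
    (hrare : RareAfterRecords μ (good h L c) ε) (hS : ∀ k ∈ S, k + L ≤ m) :
    μ (goodFrom h L c m ∩ ⋂ k ∈ S, goodFrom h L c k) ≤ ε * μ (⋂ k ∈ S, goodFrom h L c k) := by
  set A : Set (ℕ → ℤ) := ⋂ k ∈ S, goodFrom h L c k
  have hdep : ∀ t, DependsOn (· ∈ A ∩ {Z | FirstHit Z m t}) (Set.Iio (t + 1)) :=
    dependsOn_biInter_goodFrom_inter_firstHit hS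
  have hdisj : Pairwise (Function.onFun Disjoint fun t => A ∩ {Z | FirstHit Z m t}) :=
    fun _ _ hst => Set.disjoint_left.mpr fun _ hs ht => hst (hs.2.unique ht.2)
  calc μ (goodFrom h L c m ∩ A)
      = μ (⋃ t, (A ∩ {Z | FirstHit Z m t}) ∩ after t ⁻¹' good h L c) := by
        simp only [goodFrom_eq_iUnion, Set.inter_comm _ A, Set.inter_iUnion, Set.inter_assoc]
    _ ≤ ∑' t, μ ((A ∩ {Z | FirstHit Z m t}) ∩ after t ⁻¹' good h L c) := measure_iUnion_le _
    _ ≤ ∑' t, ε * μ (A ∩ {Z | FirstHit Z m t}) :=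
        ENNReal.tsum_le_tsum fun t => hrare t _ (hdep t) fun Z hZ i hi => hZ.2.1 ▸ hZ.2.2 i hi
    _ = ε * μ (⋃ t, A ∩ {Z | FirstHit Z m t}) := by
        rw [ENNReal.tsum_mul_left,
          measure_iUnion hdisj fun t => measurableSet_of_dependsOn (hdep t)]
    _ ≤ ε * μ A := by gcongr; exact Set.iUnion_subset fun t => Set.inter_subset_left

theorem RareAfterRecords.measure_biInter_goodFrom_le [IsProbabilityMeasure μ]
    (hrare : RareAfterRecords μ (good h L c) ε) (S : Finset ℕ)
    (hS : ∀ k ∈ S, ∀ m ∈ S, k < m → k + L ≤ m) :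
    μ (⋂ m ∈ S, goodFrom h L c m) ≤ ε ^ S.card := by
  induction S using Finset.induction_on_max with
  | empty =>
    rw [Finset.card_empty, pow_zero]
    exact prob_le_one
  | insert m S hm ih =>
    rw [Finset.set_biInter_insert, Finset.card_insert_of_notMem fun h => (hm m h).false, pow_succ']
    refine (hrare.measure_goodFrom_inter_biInter_le fun k hk => hS k
      (Finset.mem_insert_of_mem hk) m (Finset.mem_insert_self _ _) (hm k hk)).trans ?_
    gcongr
    exact ih fun k hk l hl =>
      hS k (Finset.mem_insert_of_mem hk) l (Finset.mem_insert_of_mem hl)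

end SeparatedStretches

section UnionBound

variable {L q : ℕ}

theorem exists_subset_residueClass_of_lt (hL : 0 < L) {n : ℕ} {T : Finset ℕ}
    (hT : T ⊆ Finset.range n) (hn : n < q * T.card) :
    ∃ ρ ∈ Finset.range L, ∃ S ∈ Finset.powersetCard (n / (q * L) + 1)
      ((Finset.range n).filter fun m => m % L = ρ), S ⊆ T := by
  have hcard : (Finset.range L).card * (n / (q * L)) < T.card := by
    rw [Finset.card_range]
    refine lt_of_mul_lt_mul_left (a := q) ?_ (Nat.zero_le q)
    rw [← mul_assoc]
    exact (Nat.mul_div_le n (q * L)).trans_lt hn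
  obtain ⟨ρ, hρ, hlt⟩ := Finset.exists_lt_card_fiber_of_mul_lt_card_of_maps_to
    (fun m _ => Finset.mem_range.mpr (Nat.mod_lt m hL)) hcard
  obtain ⟨S, hS, hScard⟩ := Finset.exists_subset_card_eq (Nat.succ_le_of_lt hlt)
  exact ⟨ρ, hρ, S, Finset.mem_powersetCard.mpr
    ⟨hS.trans (Finset.filter_subset_filter _ hT), hScard⟩, hS.trans (Finset.filter_subset _ _)⟩

theorem card_powersetCard_residueClass_le (hL : 0 < L) (hq : 0 < q) (n ρ : ℕ) :
    (Finset.powersetCard (n / (q * L) + 1)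
      ((Finset.range n).filter fun m => m % L = ρ)).card ≤ 2 ^ (q * (n / (q * L) + 1)) := by
  rw [Finset.card_powersetCard]
  refine Nat.choose_le_two_pow _ _ |>.trans (Nat.pow_le_pow_right two_pos ?_)
  have hclass : ((Finset.range n).filter fun m => m % L = ρ).card ≤ n / L + 1 := by
    calc _ ≤ ((Finset.range n).filter (· ≡ ρ [MOD L])).card :=
          Finset.card_le_card (Finset.monotone_filter_right _
            fun m _ (hm : m % L = ρ) => hm ▸ (Nat.mod_modEq m L).symm)
      _ = n / L + if ρ % L < n % L then 1 else 0 := by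
          rw [← Nat.count_eq_card_filter_range, Nat.count_modEq_card n hL]
      _ ≤ n / L + 1 := by gcongr; split_ifs <;> omega
  have : n / L < q * (n / (q * L) + 1) := by
    rw [Nat.div_lt_iff_lt_mul hL, mul_right_comm]
    exact Nat.lt_mul_div_succ n (Nat.mul_pos hq hL)
  omega

theorem tsum_half_pow_div_ne_top {k : ℕ} (hk : 0 < k) :
    ∑' n : ℕ, (2⁻¹ : ℝ≥0∞) ^ (n / k + 1) ≠ ∞ := by
  have : NeZero k := ⟨hk.ne'⟩
  have hreindex : ∑' n : ℕ, (2⁻¹ : ℝ≥0∞) ^ (n / k + 1) =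
      ∑' p : ℕ × Fin k, (2⁻¹ : ℝ≥0∞) ^ (p.1 + 1) := by
    rw [← (Nat.divModEquiv k).tsum_eq]
    rfl
  rw [hreindex, ENNReal.tsum_prod (f := fun (i : ℕ) (_ : Fin k) => (2⁻¹ : ℝ≥0∞) ^ (i + 1))]
  simp only [tsum_fintype, Finset.sum_const, Finset.card_univ, Fintype.card_fin, nsmul_eq_mul]
  rw [ENNReal.tsum_mul_left, ENNReal.tsum_geometric_add_one, ENNReal.one_sub_inv_two, inv_inv]
  finiteness

variable {Ω : Type*} [MeasurableSpace Ω] {μ : Measure Ω} {G : ℕ → Set Ω}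

theorem measure_biInter_residueClass_le
    (hG : ∀ S : Finset ℕ, (∀ k ∈ S, ∀ m ∈ S, k < m → k + L ≤ m) →
      μ (⋂ m ∈ S, G m) ≤ (2⁻¹ ^ (q + 1)) ^ S.card)
    {k n ρ : ℕ} {S : Finset ℕ}
    (hS : S ∈ Finset.powersetCard k ((Finset.range n).filter fun m => m % L = ρ)) :
    μ (⋂ m ∈ S, G m) ≤ (2⁻¹ ^ (q + 1)) ^ k := by
  obtain ⟨hsub, rfl⟩ := Finset.mem_powersetCard.mp hS
  refine hG S fun i hi j hj hij => ?_
  have hmod : i % L = j % L :=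
    (Finset.mem_filter.mp (hsub hi)).2.trans (Finset.mem_filter.mp (hsub hj)).2.symm
  have := Nat.le_of_dvd (by omega) ((Nat.modEq_iff_dvd' hij.le).mp hmod)
  omega

open Classical in
theorem measure_lt_mul_card_le (hL : 0 < L) (hq : 0 < q)
    (hG : ∀ S : Finset ℕ, (∀ k ∈ S, ∀ m ∈ S, k < m → k + L ≤ m) →
      μ (⋂ m ∈ S, G m) ≤ (2⁻¹ ^ (q + 1)) ^ S.card) (n : ℕ) :
    μ {x | n < q * ((Finset.range n).filter fun m => x ∈ G m).card} ≤
      L * 2⁻¹ ^ (n / (q * L) + 1) := by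
  set k := n / (q * L) + 1
  set 𝒮 : ℕ → Finset (Finset ℕ) := fun ρ =>
    Finset.powersetCard k ((Finset.range n).filter fun m => m % L = ρ)
  have hsub : {x | n < q * ((Finset.range n).filter fun m => x ∈ G m).card} ⊆
      ⋃ ρ ∈ Finset.range L, ⋃ S ∈ 𝒮 ρ, ⋂ m ∈ S, G m := fun x hx => by
    obtain ⟨ρ, hρ, S, hS, hSx⟩ :=
      exists_subset_residueClass_of_lt hL (Finset.filter_subset (fun m => x ∈ G m) _) hx
    exact Set.mem_biUnion hρ (Set.mem_biUnion hS
      (Set.mem_iInter₂.mpr fun m hm => (Finset.mem_filter.mp (hSx hm)).2))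
  have hhalf : (2 : ℝ≥0∞) ^ q * 2⁻¹ ^ (q + 1) = 2⁻¹ := by
    rw [pow_succ, ← mul_assoc, ← mul_pow, ENNReal.mul_inv_cancel two_ne_zero ENNReal.ofNat_ne_top,
      one_pow, one_mul]
  calc _ ≤ ∑ ρ ∈ Finset.range L, ∑ S ∈ 𝒮 ρ, μ (⋂ m ∈ S, G m) :=
        (measure_mono hsub).trans ((measure_biUnion_finset_le _ _).trans
          (Finset.sum_le_sum fun ρ _ => measure_biUnion_finset_le _ _))
    _ ≤ ∑ ρ ∈ Finset.range L, ∑ _S ∈ 𝒮 ρ, (2⁻¹ ^ (q + 1)) ^ k :=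
        Finset.sum_le_sum fun ρ _ => Finset.sum_le_sum fun _ hS =>
          measure_biInter_residueClass_le hG hS
    _ ≤ ∑ ρ ∈ Finset.range L, ((2 ^ (q * k) : ℕ) : ℝ≥0∞) * (2⁻¹ ^ (q + 1)) ^ k := by
        refine Finset.sum_le_sum fun ρ _ => ?_
        rw [Finset.sum_const, nsmul_eq_mul]
        gcongr
        exact card_powersetCard_residueClass_le hL hq n ρ
    _ = L * 2⁻¹ ^ k := by
        rw [Finset.sum_const, Finset.card_range, nsmul_eq_mul, Nat.cast_pow, Nat.cast_ofNat,
          pow_mul, ← mul_pow, hhalf]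

open Classical in
theorem ae_eventually_mul_card_le (hL : 0 < L) (hq : 0 < q)
    (hG : ∀ S : Finset ℕ, (∀ k ∈ S, ∀ m ∈ S, k < m → k + L ≤ m) →
      μ (⋂ m ∈ S, G m) ≤ (2⁻¹ ^ (q + 1)) ^ S.card) :
    ∀ᵐ x ∂μ, ∀ᶠ n in atTop, q * ((Finset.range n).filter fun m => x ∈ G m).card ≤ n := by
  have hsum : ∑' n : ℕ, (L : ℝ≥0∞) * 2⁻¹ ^ (n / (q * L) + 1) ≠ ∞ := by
    rw [ENNReal.tsum_mul_left]
    exact ENNReal.mul_ne_top (ENNReal.natCast_ne_top _)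
      (tsum_half_pow_div_ne_top (Nat.mul_pos hq hL))
  have hnull := measure_setOfPred_frequently_eq_zero
    (ne_top_of_le_ne_top hsum (ENNReal.tsum_le_tsum (measure_lt_mul_card_le hL hq hG)))
  filter_upwards [measure_eq_zero_iff_ae_notMem.mp hnull] with x hx
  exact (not_frequently.mp hx).mono fun n hn => not_lt.mp hn

end UnionBound

section PositiveSpeed

variable {Z : ℕ → ℤ}

/-- The first time at which `Z` is at level `m` or above; the junk value is `0` if there is none. -/
noncomputable def hitTime (Z : ℕ → ℤ) (m : ℤ) : ℕ := sInf {t | m ≤ Z t}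

theorem hitTime_le {m : ℤ} {k : ℕ} (hk : m ≤ Z k) : hitTime Z m ≤ k := Nat.sInf_le hk

theorem hitTime_mono {m m' : ℤ} {k : ℕ} (hk : m' ≤ Z k) (hm : m ≤ m') :
    hitTime Z m ≤ hitTime Z m' :=
  hitTime_le (hm.trans (Nat.sInf_mem (s := {t | m' ≤ Z t}) ⟨k, hk⟩))

theorem firstHit_hitTime (hstep : ∀ n, |Z (n + 1) - Z n| ≤ 1) {m : ℤ} {k : ℕ} (h0 : Z 0 ≤ m)
    (hk : m ≤ Z k) : FirstHit Z m (hitTime Z m) := by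
  have hreach : m ≤ Z (hitTime Z m) := Nat.sInf_mem (s := {t | m ≤ Z t}) ⟨k, hk⟩
  have hbelow : ∀ s < hitTime Z m, Z s < m := fun s hs => not_le.mp (Nat.notMem_of_lt_sInf hs)
  refine ⟨le_antisymm ?_ hreach, hbelow⟩
  cases hT : hitTime Z m with
  | zero => exact h0
  | succ t =>
    have := hbelow t (by omega)
    have := abs_le.mp (hstep t)
    omega

theorem sub_le_of_steps (hstep : ∀ n, |Z (n + 1) - Z n| ≤ 1) (n k : ℕ) : Z n - k ≤ Z (n + k) := by
  induction k with
  | zero => simp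
  | succ k ih =>
    have := abs_le.mp (hstep (n + k))
    rw [← add_assoc]
    push_cast
    omega

/-- The time between the first visits to the levels `w` and `w + 1`. -/
noncomputable def crossingTime (Z : ℕ → ℤ) (w : ℕ) : ℕ := hitTime Z (w + 1) - hitTime Z w

theorem sum_crossingTime_le {n k : ℕ} (hn : n ≤ Z k) :
    ∑ w ∈ Finset.range n, crossingTime Z w ≤ hitTime Z n := by
  induction n with
  | zero => simp
  | succ n ih =>
    have hsucc := hitTime_mono hn (Int.ofNat_le.mpr n.le_succ)
    have := ih ((Int.ofNat_le.mpr n.le_succ).trans hn)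
    rw [Finset.sum_range_succ, crossingTime]
    push_cast at hsucc ⊢
    omega

theorem exists_le_lt_succ {T : ℕ → ℕ} {m L t : ℕ} (hm : T m ≤ t) (hL : t < T (m + L)) :
    ∃ w, m ≤ w ∧ w < m + L ∧ T w ≤ t ∧ t < T (w + 1) := by
  induction L with
  | zero => exact absurd hL (not_lt.mpr hm)
  | succ L ih =>
    rcases lt_or_ge t (T (m + L)) with hlt | hge
    · obtain ⟨w, hmw, hwL, hw⟩ := ih hlt
      exact ⟨w, hmw, by omega, hw⟩
    · exact ⟨m + L, by omega, by omega, hge, hL⟩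

open Classical in
/-- The levels `m < n` from which the sequence, between its first visits to `m` and to `m + L ≤ n`,
falls back by at least `h`. -/
noncomputable def backtrackingLevels (h L n : ℕ) (Z : ℕ → ℤ) : Finset ℕ :=
  (Finset.range n).filter fun m => m + L ≤ n ∧
    ∃ t, hitTime Z m ≤ t ∧ t < hitTime Z (m + L : ℕ) ∧ Z t ≤ m - h

open Classical in
/-- The levels `m < n` for which, up to time `T`, some level `m + j` is visited more than
`c (|j| + 1)²` times. -/
noncomputable def crowdedLevels (c n T : ℕ) (Z : ℕ → ℤ) : Finset ℕ :=
  (Finset.range n).filter fun m => ∃ j : ℤ,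
    c * (j.natAbs + 1) ^ 2 < Nat.count (fun t => Z t = m + j) T

open Classical in
/-- The levels `m < n` at whose first visit a good stretch of length `L` begins. -/
noncomputable def goodLevels (h L c n : ℕ) (Z : ℕ → ℤ) : Finset ℕ :=
  (Finset.range n).filter fun m => Z ∈ goodFrom h L c m

theorem mem_backtrackingLevels {h L n m : ℕ} : m ∈ backtrackingLevels h L n Z ↔ m < n ∧
    m + L ≤ n ∧ ∃ t, hitTime Z m ≤ t ∧ t < hitTime Z (m + L : ℕ) ∧ Z t ≤ m - h := by
  simp only [backtrackingLevels, Finset.mem_filter, Finset.mem_range]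

theorem mem_crowdedLevels {c n T m : ℕ} : m ∈ crowdedLevels c n T Z ↔ m < n ∧
    ∃ j : ℤ, c * (j.natAbs + 1) ^ 2 < Nat.count (fun t => Z t = m + j) T := by
  simp only [crowdedLevels, Finset.mem_filter, Finset.mem_range]

theorem mem_goodLevels {h L c n m : ℕ} :
    m ∈ goodLevels h L c n Z ↔ m < n ∧ Z ∈ goodFrom h L c m := by
  simp only [goodLevels, Finset.mem_filter, Finset.mem_range]

theorem exists_crossingTime_ge_of_mem_backtrackingLevels
    (hstep : ∀ n, |Z (n + 1) - Z n| ≤ 1) (h0 : Z 0 ≤ 0) {h L n k m : ℕ} (hn : n ≤ Z k)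
    (hm : m ∈ backtrackingLevels h L n Z) :
    ∃ w < n, m ≤ w ∧ w < m + L ∧ w - m + h ≤ crossingTime Z w := by
  obtain ⟨-, hmL, t, hmt, htL, hZt⟩ := mem_backtrackingLevels.mp hm
  obtain ⟨w, hmw, hwL, hwt, htw⟩ := exists_le_lt_succ (T := fun i => hitTime Z i) hmt htL
  have hhit : FirstHit Z w (hitTime Z w) := firstHit_hitTime hstep (by omega) (k := k) (by omega)
  have hfall := sub_le_of_steps hstep (hitTime Z w) (t - hitTime Z w)
  rw [Nat.add_sub_cancel' hwt, hhit.1] at hfall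
  refine ⟨w, by omega, hmw, hwL, ?_⟩
  rw [crossingTime]
  push_cast at htw hfall
  omega

theorem card_backtrackingLevels_le (hstep : ∀ n, |Z (n + 1) - Z n| ≤ 1) (h0 : Z 0 ≤ 0)
    {h L n k : ℕ} (hn : n ≤ Z k) (hh : 1 ≤ h) :
    (backtrackingLevels h L n Z).card ≤ ∑ w ∈ Finset.range n,
      if h ≤ crossingTime Z w then min (crossingTime Z w) L else 0 := by
  set near : ℕ → Finset ℕ := fun w =>
    (Finset.range n).filter fun m => m ≤ w ∧ w < m + L ∧ w - m + h ≤ crossingTime Z w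
  have hsub : backtrackingLevels h L n Z ⊆ (Finset.range n).biUnion near := fun m hm => by
    obtain ⟨w, hwn, hw⟩ := exists_crossingTime_ge_of_mem_backtrackingLevels hstep h0 hn hm
    exact Finset.mem_biUnion.mpr
      ⟨w, Finset.mem_range.mpr hwn, Finset.mem_filter.mpr ⟨Finset.mem_range.mpr (by omega), hw⟩⟩
  refine (Finset.card_le_card hsub).trans (Finset.card_biUnion_le.trans
    (Finset.sum_le_sum fun w _ => ?_))
  have hnear : (near w).card ≤ (Finset.range (min L (crossingTime Z w + 1 - h))).card := by
    refine Finset.card_le_card_of_injOn (w - ·) (fun m hm => ?_) fun m hm m' hm' heq => ?_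
    · have := (Finset.mem_filter.mp hm).2
      simp only [Finset.coe_range, Set.mem_Iio]
      omega
    · have := (Finset.mem_filter.mp hm).2
      have := (Finset.mem_filter.mp hm').2
      simp only at heq
      omega
  rw [Finset.card_range] at hnear
  split_ifs <;> omega

theorem sum_scales_le {h L : ℕ → ℕ} (hL : ∀ i, h i ≤ L i) (hh : ∀ i, 2 * L i ≤ h (i + 1))
    (b J : ℕ) : ∑ i ∈ Finset.range J, (if h i ≤ b then min b (L i) else 0) ≤ 2 * b := by
  have hsum : ∀ J, ∑ i ∈ Finset.range J, L i ≤ h J := by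
    intro J
    induction J with
    | zero => simp
    | succ J ih =>
      rw [Finset.sum_range_succ]
      have := hL J
      have := hh J
      omega
  induction J with
  | zero => simp
  | succ J ih =>
    rw [Finset.sum_range_succ]
    split_ifs with hb
    · have hlower : ∑ i ∈ Finset.range J, (if h i ≤ b then min b (L i) else 0) ≤
          ∑ i ∈ Finset.range J, L i := Finset.sum_le_sum fun i _ => by
        split_ifs
        exacts [min_le_right _ _, Nat.zero_le _]
      have := hsum J
      have := min_le_left b (L J)
      omega
    · simpa only [add_zero] using ih

theorem sum_card_backtrackingLevels_le (hstep : ∀ n, |Z (n + 1) - Z n| ≤ 1) (h0 : Z 0 ≤ 0)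
    {n k : ℕ} (hn : n ≤ Z k) {h L : ℕ → ℕ} (h1 : ∀ i, 1 ≤ h i) (hL : ∀ i, h i ≤ L i)
    (hh : ∀ i, 2 * L i ≤ h (i + 1)) (J : ℕ) :
    ∑ i ∈ Finset.range J, (backtrackingLevels (h i) (L i) n Z).card ≤ 2 * k := by
  calc _ ≤ ∑ i ∈ Finset.range J, ∑ w ∈ Finset.range n,
        (if h i ≤ crossingTime Z w then min (crossingTime Z w) (L i) else 0) :=
        Finset.sum_le_sum fun i _ => card_backtrackingLevels_le hstep h0 hn (h1 i)
    _ = ∑ w ∈ Finset.range n, ∑ i ∈ Finset.range J,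
          (if h i ≤ crossingTime Z w then min (crossingTime Z w) (L i) else 0) := Finset.sum_comm
    _ ≤ ∑ w ∈ Finset.range n, 2 * crossingTime Z w :=
        Finset.sum_le_sum fun w _ => sum_scales_le hL hh _ _
    _ = 2 * ∑ w ∈ Finset.range n, crossingTime Z w := (Finset.mul_sum _ _ _).symm
    _ ≤ 2 * k := Nat.mul_le_mul_left _ ((sum_crossingTime_le hn).trans (hitTime_le hn))

theorem mul_card_sq_lt_le (c N n : ℕ) (k : ℤ) :
    c * ((Finset.range n).filter fun m : ℕ => c * ((k - m).natAbs + 1) ^ 2 < N).card ≤ 2 * N := by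
  rcases Nat.eq_zero_or_pos c with rfl | hc
  · simp
  set q := Nat.sqrt (N / c) with hq
  have hcard : ((Finset.range n).filter fun m : ℕ => c * ((k - m).natAbs + 1) ^ 2 < N).card ≤
      (Finset.Ioo (k - q) (k + q)).card := by
    refine Finset.card_le_card_of_injOn (fun m : ℕ => (m : ℤ)) (fun m hm => ?_)
      Nat.cast_injective.injOn
    have : (k - m).natAbs + 1 ≤ q := by
      rw [hq, Nat.le_sqrt', Nat.le_div_iff_mul_le hc, mul_comm]
      exact (Finset.mem_filter.mp hm).2.le
    simp only [Finset.coe_Ioo, Set.mem_Ioo]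
    omega
  rw [Int.card_Ioo] at hcard
  have hcq : c * q ≤ N := (Nat.mul_le_mul_left c ((Nat.le_self_pow two_ne_zero q).trans
    (Nat.sqrt_le' _))).trans (Nat.mul_div_le N c)
  calc _ ≤ c * (2 * q) := Nat.mul_le_mul_left _ (by omega)
    _ ≤ 2 * N := by linarith

theorem mul_card_crowdedLevels_le (c n T : ℕ) (Z : ℕ → ℤ) :
    c * (crowdedLevels c n T Z).card ≤ 2 * T := by
  set N : ℤ → ℕ := fun k => Nat.count (fun t => Z t = k) T with hN
  set K := (Finset.range T).image Z
  set crowdedBy : ℤ → Finset ℕ := fun k =>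
    (Finset.range n).filter fun m => c * ((k - m).natAbs + 1) ^ 2 < N k
  have hsub : crowdedLevels c n T Z ⊆ K.biUnion crowdedBy := fun m hm => by
    obtain ⟨hmn, j, hj⟩ := mem_crowdedLevels.mp hm
    have hvisited := (Nat.zero_le _).trans_lt hj
    rw [Nat.count_eq_card_filter_range, Finset.card_pos] at hvisited
    obtain ⟨t, ht⟩ := hvisited
    obtain ⟨htT, htj⟩ := Finset.mem_filter.mp ht
    refine Finset.mem_biUnion.mpr ⟨m + j, htj ▸ Finset.mem_image_of_mem _ htT,
      Finset.mem_filter.mpr ⟨Finset.mem_range.mpr hmn, ?_⟩⟩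
    rwa [add_sub_cancel_left]
  have hvisits : ∑ k ∈ K, N k = T := by
    simp only [hN, Nat.count_eq_card_filter_range]
    rw [← Finset.card_eq_sum_card_image, Finset.card_range]
  calc _ ≤ c * ∑ k ∈ K, (crowdedBy k).card :=
        Nat.mul_le_mul_left _ ((Finset.card_le_card hsub).trans Finset.card_biUnion_le)
    _ ≤ ∑ k ∈ K, 2 * N k := by
        rw [Finset.mul_sum]
        exact Finset.sum_le_sum fun k _ => mul_card_sq_lt_le c (N k) n k
    _ = 2 * T := by rw [← Finset.mul_sum, hvisits]

theorem mem_goodFrom_of_notMem (hstep : ∀ n, |Z (n + 1) - Z n| ≤ 1) (h0 : Z 0 ≤ 0)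
    {h L c n k m : ℕ} (hh : 1 ≤ h) (hn : n ≤ Z k) (hmn : m < n) (hmL : m + L ≤ n)
    (hback : m ∉ backtrackingLevels h L n Z) (hcrowded : m ∉ crowdedLevels c n k Z) :
    Z ∈ goodFrom h L c m := by
  have hstart : FirstHit Z m (hitTime Z m) := firstHit_hitTime hstep (k := k) (by omega) (by omega)
  have hend : FirstHit Z (m + L : ℕ) (hitTime Z (m + L : ℕ)) :=
    firstHit_hitTime hstep (k := k) (by omega) (by omega)
  have hle : hitTime Z m ≤ hitTime Z (m + L : ℕ) := hitTime_mono (k := k) (by omega) (by omega)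
  have hkend : hitTime Z (m + L : ℕ) ≤ k := hitTime_le (by omega)
  simp only [mem_backtrackingLevels, mem_crowdedLevels, hmn, hmL, true_and,
    not_exists, not_and, not_le, not_lt] at hback hcrowded
  refine ⟨hitTime Z m, hstart,
    Set.mem_iUnion.mpr ⟨hitTime Z (m + L : ℕ) - hitTime Z m, ?_, ?_, fun j => ?_⟩⟩
  all_goals simp only [FirstHit, after, add_zero, hstart.1, Nat.add_sub_cancel' hle, hend.1]
  · exact ⟨Nat.cast_add m L, fun s hs => by
      have := hend.2 (hitTime Z m + s) (by omega)
      omega⟩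
  · intro t ht
    rcases ht.eq_or_lt with rfl | hlt
    · rw [Nat.add_sub_cancel' hle, hend.1]
      push_cast
      omega
    · exact hback _ (Nat.le_add_right _ _) (by omega)
  · calc _ ≤ Nat.count (fun t => Z t = m + j) (hitTime Z (m + L : ℕ)) := by
          rw [← Nat.add_sub_cancel' hle, Nat.count_add, Nat.add_sub_cancel' hle]
          exact Nat.le_add_left _ _
      _ ≤ Nat.count (fun t => Z t = m + j) k := Nat.count_monotone _ hkend
      _ ≤ c * (j.natAbs + 1) ^ 2 := hcrowded j

theorem exists_lt_mul_card_goodLevels (hstep : ∀ n, |Z (n + 1) - Z n| ≤ 1) (h0 : Z 0 ≤ 0)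
    {A n k : ℕ} (hA : 0 < A) (hn : n ≤ Z k) (hk : k ≤ A * n) {h L : ℕ → ℕ} (h1 : ∀ i, 1 ≤ h i)
    (hL : ∀ i, h i ≤ L i) (hh : ∀ i, 2 * L i ≤ h (i + 1)) (hlong : ∀ i < 8 * A, 4 * L i < n) :
    ∃ i < 8 * A, n < 4 * (goodLevels (h i) (L i) (8 * A) n Z).card := by
  obtain ⟨i, hi, hback⟩ : ∃ i < 8 * A, 4 * (backtrackingLevels (h i) (L i) n Z).card ≤ n := by
    by_contra! hcon
    have hsum : ∑ _i ∈ Finset.range (8 * A), (n + 1) ≤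
        ∑ i ∈ Finset.range (8 * A), 4 * (backtrackingLevels (h i) (L i) n Z).card :=
      Finset.sum_le_sum fun i hi => hcon i (Finset.mem_range.mp hi)
    rw [← Finset.mul_sum, Finset.sum_const, Finset.card_range, smul_eq_mul] at hsum
    have := sum_card_backtrackingLevels_le hstep h0 hn h1 hL hh (8 * A)
    nlinarith
  have hcrowded : 4 * (crowdedLevels (8 * A) n k Z).card ≤ n := by
    have := mul_card_crowdedLevels_le (8 * A) n k Z
    nlinarith
  refine ⟨i, hi, ?_⟩
  have hcover : Finset.range n ⊆ goodLevels (h i) (L i) (8 * A) n Z ∪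
      (backtrackingLevels (h i) (L i) n Z ∪
        (crowdedLevels (8 * A) n k Z ∪ Finset.Ico (n - L i) n)) := fun m hm => by
    have hmn := Finset.mem_range.mp hm
    by_contra hout
    simp only [Finset.mem_union, Finset.mem_Ico, not_or, not_and, not_lt] at hout
    obtain ⟨hgood, hb, hc, hend⟩ := hout
    exact hgood (mem_goodLevels.mpr
      ⟨hmn, mem_goodFrom_of_notMem hstep h0 (h1 i) hn hmn (by omega) hb hc⟩)
  have hcard := (Finset.card_le_card hcover).trans ((Finset.card_union_le _ _).trans
    (Nat.add_le_add_left ((Finset.card_union_le _ _).trans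
      (Nat.add_le_add_left (Finset.card_union_le _ _) _)) _))
  rw [Finset.card_range, Nat.card_Ico] at hcard
  have := hlong i hi
  omega

end PositiveSpeed

section Speed

theorem limsup_div_nonpos {Z : ℕ → ℤ}
    (hslow : ∀ A : ℕ, 0 < A → ∀ᶠ n : ℕ in atTop, ∀ k : ℕ, k ≤ A * n → Z k < (n : ℤ)) :
    limsup (fun n : ℕ => (((Z n : ℝ) / (n : ℝ) : ℝ) : EReal)) atTop ≤ 0 := by
  refine EReal.le_of_forall_lt_iff_le.mp fun b hb => ?_
  have hb : 0 < b := by exact_mod_cast hb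
  obtain ⟨A, hA⟩ := exists_nat_ge b⁻¹
  have hA0 : (0 : ℝ) < A := (inv_pos.mpr hb).trans_le hA
  have hApos : 0 < A := by exact_mod_cast hA0
  have hlevel : Tendsto (fun k => k / A + 1) atTop atTop :=
    (tendsto_add_atTop_nat 1).comp (Nat.tendsto_div_const_atTop hApos.ne')
  refine limsup_le_of_le (by isBoundedDefault) ?_
  filter_upwards [hlevel.eventually (hslow A hApos)] with k hk
  have hZ : Z k ≤ ((k / A : ℕ) : ℤ) := Int.lt_add_one_iff.mp
    (by exact_mod_cast hk k (Nat.lt_mul_div_succ k hApos).le)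
  refine EReal.coe_le_coe_iff.mpr (div_le_of_le_mul₀ (Nat.cast_nonneg k) hb.le ?_)
  calc (Z k : ℝ) ≤ ((k / A : ℕ) : ℝ) :=
        (Int.cast_le.mpr hZ).trans_eq (Int.cast_natCast _)
    _ ≤ k / A := Nat.cast_div_le
    _ ≤ b * k := by
        rw [div_eq_inv_mul]
        gcongr
        exact inv_le_of_inv_le₀ hb hA

theorem exists_scales {p : ℕ → ℕ → Prop} (hp : ∀ h, ∃ L, h ≤ L ∧ p h L) :
    ∃ h L : ℕ → ℕ, (∀ i, 1 ≤ h i) ∧ (∀ i, h i ≤ L i) ∧ (∀ i, 2 * L i ≤ h (i + 1)) ∧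
      ∀ i, p (h i) (L i) := by
  choose L hL hpL using hp
  set h : ℕ → ℕ := fun i => (fun k => 2 * L k)^[i] 1
  have hsucc : ∀ i, h (i + 1) = 2 * L (h i) := fun i => Function.iterate_succ_apply' _ i 1
  refine ⟨h, L ∘ h, fun i => ?_, fun i => hL _, fun i => (hsucc i).ge, fun i => hpL _⟩
  induction i with
  | zero => exact le_rfl
  | succ i ih =>
    have := hL (h i)
    rw [hsucc]
    omega

variable {ν : Measure (ℕ → ℤ)} [IsProbabilityMeasure ν]

theorem ae_eventually_forall_le_lt (h0 : ∀ᵐ Z ∂ν, Z 0 ≤ 0)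
    (hstep : ∀ᵐ Z ∂ν, ∀ n, |Z (n + 1) - Z n| ≤ 1)
    (hrare : ∀ h c, ∀ᶠ L in atTop, RareAfterRecords ν (good h L c) (2⁻¹ ^ 5)) {A : ℕ} (hA : 0 < A) :
    ∀ᵐ Z ∂ν, ∀ᶠ n : ℕ in atTop, ∀ k : ℕ, k ≤ A * n → Z k < (n : ℤ) := by
  obtain ⟨h, L, h1, hL, hh, hrareL⟩ := exists_scales fun h =>
    ((eventually_ge_atTop h).and (hrare h (8 * A))).exists
  have hfew : ∀ i, ∀ᵐ Z ∂ν, ∀ᶠ n in atTop, 4 * (goodLevels (h i) (L i) (8 * A) n Z).card ≤ n :=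
    fun i => ae_eventually_mul_card_le ((h1 i).trans (hL i)) four_pos
      ((hrareL i).measure_biInter_goodFrom_le)
  filter_upwards [h0, hstep, ae_all_iff.mpr hfew] with Z hZ0 hZstep hZfew
  filter_upwards [(Finset.eventually_all (Finset.range (8 * A))).mpr fun i _ => hZfew i,
    (Finset.eventually_all (Finset.range (8 * A))).mpr fun i _ => eventually_gt_atTop (4 * L i)]
    with n hn hlong k hk
  by_contra! hnk
  obtain ⟨i, hi, hmany⟩ := exists_lt_mul_card_goodLevels hZstep hZ0 hA hnk hk h1 hL hh
    fun i hi => hlong i (Finset.mem_range.mpr hi)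
  exact hmany.not_ge (hn i (Finset.mem_range.mpr hi))

theorem ae_limsup_div_nonpos (h0 : ∀ᵐ Z ∂ν, Z 0 ≤ 0)
    (hstep : ∀ᵐ Z ∂ν, ∀ n, |Z (n + 1) - Z n| ≤ 1)
    (hrare : ∀ h c, ∀ᶠ L in atTop, RareAfterRecords ν (good h L c) (2⁻¹ ^ 5)) :
    ∀ᵐ Z ∂ν, limsup (fun n : ℕ => (((Z n : ℝ) / (n : ℝ) : ℝ) : EReal)) atTop ≤ 0 := by
  filter_upwards [ae_all_iff.mpr fun A => ae_all_iff.mpr fun hA : 0 < A =>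
    ae_eventually_forall_le_lt h0 hstep hrare hA] with Z hZ
  exact limsup_div_nonpos hZ

end Speed

section Walk

variable {d : ℕ}

theorem annealedLaw_snd (P : Measure (Env d)) [SFinite P] (x : Site d) :
    (annealedLaw P x).snd = pathLaw P x :=
  Measure.snd_compProd _ _

theorem abs_coord_sub_le_of_stepKernel_ne_zero {ω : Env d} {y z : Site d}
    (h : stepKernel ω y {z} ≠ 0) (i : Fin d) : |z i - y i| ≤ 1 := by
  rw [stepKernel_apply_apply] at h
  obtain ⟨v, -, hv⟩ := Finset.exists_ne_zero_of_sum_ne_zero h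
  obtain rfl : y + (v : Site d) = z := by
    by_contra hne
    refine hv ?_
    rw [Measure.dirac_apply' _ .of_discrete,
      Set.indicator_of_notMem (show y + (v : Site d) ∉ ({z} : Set (Site d)) from hne), mul_zero]
  rw [Pi.add_apply, add_sub_cancel_left, ← sq_le_one_iff_abs_le_one]
  exact (Finset.single_le_sum (f := fun i => (v : Site d) i ^ 2) (fun j _ => sq_nonneg _)
    (Finset.mem_univ i)).trans ((mem_steps _).mp v.2)

variable [NeZero d]

theorem ae_map_height (μ : Measure (Env d)) (x : Site d) {p : (ℕ → ℤ) → Prop}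
    (hp : MeasurableSet {Z | p Z})
    (h : ∀ ω : Env d, ∀ᵐ X ∂chainLaw (stepKernel ω) x, p (height X)) :
    ∀ᵐ Z ∂(pathLaw μ x).map height, p Z :=
  (ae_map_iff measurable_height.aemeasurable hp).mpr
    ((pathLaw_eq_zero_iff μ x (measurable_height hp).compl).mpr (ae_of_all _ h))

theorem ae_map_height_zero (μ : Measure (Env d)) (x : Site d) :
    ∀ᵐ Z ∂(pathLaw μ x).map height, Z 0 = x 0 :=
  ae_map_height μ x (measurableSet_eq_fun (measurable_pi_apply 0) measurable_const) fun _ =>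
    (ae_chainLaw_zero _ x).mono fun _ hX => congrFun hX 0

theorem ae_map_height_step (μ : Measure (Env d)) (x : Site d) :
    ∀ᵐ Z ∂(pathLaw μ x).map height, ∀ n, |Z (n + 1) - Z n| ≤ 1 :=
  ae_all_iff.mpr fun n => ae_map_height μ x
    (((measurable_pi_apply (n + 1)).sub (measurable_pi_apply n)).abs measurableSet_Iic) fun _ =>
      (ae_chainLaw_transition_ne_zero _ x).mono fun _ hX =>
        abs_coord_sub_le_of_stepKernel_ne_zero (hX n) 0

theorem visits_eq_count (X : ℕ → Site d) (j n : ℕ) :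
    visits X j n = Nat.count (fun t => height X t = height X 0 + j) (n + 1) := by
  rw [visits, Nat.count_eq_card_filter_range, Finset.card_filter]
  refine Finset.sum_congr rfl fun t _ => ?_
  simp only [level, height, Set.mem_ofPred_eq]
  congr

theorem timeR_eq_top_iff {c : ℕ} {X : ℕ → Site d} : timeR c X = ⊤ ↔ height X ∈ escape c := by
  have hvisits : (∀ n j : ℕ, (visits X j n : ℝ) ≤ (c : ℝ) * ((j : ℝ) + 1) ^ 2) ↔
      ∀ j n : ℕ, Nat.count (fun t => height X t = height X 0 + j) n ≤ c * (j + 1) ^ 2 := by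
    simp only [visits_eq_count]
    refine ⟨fun h j n => ?_, fun h n j => by exact_mod_cast h j (n + 1)⟩
    exact (Nat.count_monotone _ n.le_succ).trans (by exact_mod_cast h n j)
  have htop : timeR c X = ⊤ ↔ (∀ n j : ℕ, (visits X j n : ℝ) ≤ (c : ℝ) * ((j : ℝ) + 1) ^ 2) ∧
      ∀ n, 1 ≤ n → X 0 0 < X n 0 := by
    simp only [timeR, backtrackTime, inf_eq_top_iff, iInf_eq_top, Set.mem_ofPred_eq,
      ENat.natCast_ne_top, imp_false, not_exists, not_lt, not_and, not_le]
  rw [htop, hvisits, and_comm]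
  rfl

theorem escape_mono : Monotone escape := fun _ _ hc _ hZ =>
  ⟨hZ.1, fun j n => (hZ.2 j n).trans (Nat.mul_le_mul_right _ hc)⟩

theorem ae_upperSpeed_nonpos {P : Measure (Env d)} [IsProbabilityMeasure P]
    (hinv : TranslationInvariant P) {r : ℕ} {γ C : ℝ} (hγ : 0 < γ) (hmix : MixingBound P r γ C)
    (hnull : ∀ c, pathLaw P 0 (height ⁻¹' escape c) = 0) :
    ∀ᵐ X ∂pathLaw P 0, upperSpeed X ≤ 0 := by
  have : IsProbabilityMeasure ((pathLaw P 0).map height) :=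
    Measure.isProbabilityMeasure_map measurable_height.aemeasurable
  refine ae_of_ae_map measurable_height.aemeasurable (ae_limsup_div_nonpos ?_ ?_ fun h c =>
    eventually_rareAfterRecords_good hinv hγ hmix hnull 0 h c
      (ENNReal.pow_pos (ENNReal.inv_pos.mpr ENNReal.ofNat_ne_top) 5))
  · exact (ae_map_height_zero P 0).mono fun _ h => h.le
  · exact ae_map_height_step P 0

end Walk

end RWRE

open RWRE in
theorem theorem2p2_general (d : ℕ) [NeZero d] (P : MeasureTheory.Measure (Env d))
    [MeasureTheory.IsProbabilityMeasure P] (hinv : TranslationInvariant P) {r : ℕ} {γ C : ℝ}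
    (hγ : 0 < γ) (hmix : MixingBound P r γ C)
    (hspeed : 0 < annealedLaw P 0 {p | 0 < upperSpeed p.2}) :
    ∃ c₅ : ℝ, 0 < c₅ ∧ 0 < annealedLaw P 0 {p | timeR c₅ p.2 = ⊤} := by
  by_contra! hcon
  have hnull : ∀ c, pathLaw P 0 (height ⁻¹' escape c) = 0 := fun c => by
    refine measure_mono_null
      (Set.preimage_mono (escape_mono c.le_succ)) (nonpos_iff_eq_zero.mp ?_)
    rw [← annealedLaw_snd, Measure.snd_apply
      (measurable_height (measurableSet_escape (c + 1)))]
    have hescape := hcon (c + 1 : ℕ) (by positivity)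
    simp only [timeR_eq_top_iff] at hescape
    exact hescape
  have hslow := ae_upperSpeed_nonpos hinv hγ hmix hnull
  rw [← annealedLaw_snd] at hslow
  refine hspeed.ne' (measure_mono_null (fun p hp => ?_)
    (ae_iff.mp (ae_of_ae_map measurable_snd.aemeasurable hslow)))
  exact not_le.mpr hp

theorem theorem2p2 (d : ℕ) [NeZero d] (P : MeasureTheory.Measure (RWRE.Env d))
    [MeasureTheory.IsProbabilityMeasure P]
    (hinv : RWRE.TranslationInvariant P)
    (hell : RWRE.UniformlyElliptic P)
    (hG : RWRE.ConditionG P)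
    (hspeed : 0 < RWRE.annealedLaw P 0 {p | 0 < RWRE.upperSpeed p.2}) :
    ∃ c₅ : ℝ, 0 < c₅ ∧ 0 < RWRE.annealedLaw P 0 {p | RWRE.timeR c₅ p.2 = ⊤} := by
  obtain ⟨r, -, -, γ, C, hγ, -, hmix⟩ := hG
  exact theorem2p2_general d P hinv hγ hmix hspeed
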